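/- All graphs are finite, simple and undirected, with non-empty vertex set. A graph is \emph{outerplanar} if it has a crossing-free drawing in the plane (vertices are distinct points, edges are simple polygonal arcs) in which every vertex lies on the boundary of the outer (unbounded) face. A \emph{tree covering} of a graph $G$ is a family of vertex-disjoint induced subgraphs of $G$, each of which is a tree, that covers all vertices of $G$; the \emph{tree cover number} $T(G)$ is the smallest size of a tree covering, and a tree covering is \emph{minimum} if it has size $T(G)$. \emph{Positive zero forcing.} Let $B\subseteq V(G)$ be the set of black vertices, the others being white. If $u\in B$ and, for some connected component $C$ of $G\setminus B$, the vertex $w$ is the only neighbour of $u$ in $C$, then $u$ may \emph{force} $w$, that is, $w$ is coloured black. A set $Z\subseteq V(G)$ is a \emph{positive zero forcing set} if, starting with exactly the vertices of $Z$ black, some sequence of forces colours all vertices black. The \emph{positive zero forcing number} $Z_+(G)$ is the smallest size of a positive zero forcing set. Given such a set $Z$ and a chronological list of forces that colours all of $V(G)$, the \emph{forcing tree} with root $r\in Z$ is the subgraph of $G$ whose vertices are those reached from $r$ by successive forces in the list and whose edges are the pairs $uw$ of such vertices for which $u$ forces $w$ in the list; the \emph{set of forcing trees} of the process consists of these subgraphs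 for all $r\in Z$. \textbf{Theorem.} Let $G$ be an outerplanar graph. Then $$Z_+(G)=T(G).$$ Moreover, for every minimum tree covering $\mathcal T$ of $G$ there are a positive zero forcing set $Z$ of $G$ with $|Z|=Z_+(G)$ and a chronological list of forces, starting with $Z$ and colouring all vertices of $G$ black, whose set of forcing trees is exactly $\mathcal T$. -/

import Mathlib

namespace OuterplanarForcing

/-! ### Plane drawings and outerplanar graphs -/

/-- The plane. Only its topology, its bounded sets and its line segments are used, and these
are the same for every norm on `ℝ × ℝ`. -/
abbrev Plane : Type := ℝ × ℝ

/-- `A` is a (simple, polygonal) arc from `x` to `y`: the union of `n ≥ 1` nondegenerate line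
segments `[p 0, p 1], …, [p (n-1), p n]` with `p 0 = x` and `p n = y`, such that consecutive
segments meet only in their common endpoint and all other pairs of segments are disjoint. -/
def IsPolygonalArc (A : Set Plane) (x y : Plane) : Prop :=
  ∃ (n : ℕ) (p : ℕ → Plane), 0 < n ∧ p 0 = x ∧ p n = y ∧
    (∀ i, i < n → p i ≠ p (i + 1)) ∧
    (∀ i j, i < j → j < n → ∀ z, z ∈ segment ℝ (p i) (p (i + 1)) →
      z ∈ segment ℝ (p j) (p (j + 1)) → j = i + 1 ∧ z = p j) ∧
    A = ⋃ i ∈ Set.Iio n, segment ℝ (p i) (p (i + 1))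

/-- A planar embedding (crossing-free drawing) of the graph `G`: vertices are distinct points,
every edge is an arc joining the points of its two ends, an arc passes through no vertex other
than its ends, and two different arcs meet only in common ends. -/
structure PlaneDrawing {V : Type*} (G : SimpleGraph V) where
  pos : V → Plane
  arc : Sym2 V → Set Plane
  pos_injective : Function.Injective pos
  isArc : ∀ u v, G.Adj u v → IsPolygonalArc (arc s(u, v)) (pos u) (pos v)
  vertex_on_arc : ∀ e ∈ G.edgeSet, ∀ w, pos w ∈ arc e → w ∈ e
  arc_inter : ∀ e ∈ G.edgeSet, ∀ f ∈ G.edgeSet, e ≠ f → ∀ z, z ∈ arc e → z ∈ arc f →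
    ∃ w, w ∈ e ∧ w ∈ f ∧ z = pos w

/-- The point set of a drawing: all its vertices and edges. -/
def PlaneDrawing.carrier {V : Type*} {G : SimpleGraph V} (D : PlaneDrawing G) : Set Plane :=
  Set.range D.pos ∪ ⋃ e ∈ G.edgeSet, D.arc e

/-- The outer face of a drawing: the unbounded component of its complement in the plane. -/
def PlaneDrawing.outerFace {V : Type*} {G : SimpleGraph V} (D : PlaneDrawing G) : Set Plane :=
  {z | z ∈ D.carrierᶜ ∧ ¬ Bornology.IsBounded (connectedComponentIn D.carrierᶜ z)}

/-- A graph is outerplanar if it has a planar embedding in which every vertex lies on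
(the boundary of) the outer face. -/
def IsOuterplanar {V : Type*} (G : SimpleGraph V) : Prop :=
  ∃ D : PlaneDrawing G, ∀ v, D.pos v ∈ closure D.outerFace

/-! ### Tree coverings -/

/-- A tree covering of `G`: a family of vertex-disjoint induced subgraphs of `G`, each of which
is a tree, that covers all vertices. -/
structure IsTreeCovering {V : Type*} (G : SimpleGraph V) (𝒯 : Set G.Subgraph) : Prop where
  isInduced : ∀ H ∈ 𝒯, H.IsInduced
  isTree : ∀ H ∈ 𝒯, H.coe.IsTree
  disjoint : 𝒯.PairwiseDisjoint fun H => H.verts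
  covers : ∀ v, ∃ H ∈ 𝒯, v ∈ H.verts

/-- The tree cover number `T(G)` (of a finite graph): the least size of a tree covering. -/
noncomputable def treeCoverNumber {V : Type*} (G : SimpleGraph V) : ℕ :=
  sInf {m | ∃ 𝒯 : Set G.Subgraph, IsTreeCovering G 𝒯 ∧ 𝒯.ncard = m}

/-! ### Positive zero forcing -/

/-- The positive semidefinite colour change rule. If `B` is the set of black vertices, then `u`
can force `w` when `u` is black and, for some component `C` of `G \ B`, the vertex `w` is the
only neighbour of `u` in `C`. -/
def Forces {V : Type*} (G : SimpleGraph V) (B : Set V) (u w : V) : Prop :=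
  u ∈ B ∧ ∃ C : (G.induce Bᶜ).ConnectedComponent,
    G.neighborSet u ∩ (Subtype.val '' C.supp) = {w}

/-- `IsForcingList G B l B'`: starting with the set `B` of black vertices, the forces in the
chronological list `l` (where `(u, w)` means that `u` forces `w`) can be performed one after the
other, and afterwards `B'` is the set of black vertices. -/
inductive IsForcingList {V : Type*} (G : SimpleGraph V) : Set V → List (V × V) → Set V → Prop
  | nil (B : Set V) : IsForcingList G B [] B
  | cons {B B' : Set V} {u w : V} {l : List (V × V)} (h : Forces G B u w)
      (hl : IsForcingList G (insert w B) l B') : IsForcingList G B ((u, w) :: l) B'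

/-- `Z` is a positive zero forcing set: starting with `Z`, all vertices can be coloured black. -/
def IsPositiveZeroForcingSet {V : Type*} (G : SimpleGraph V) (Z : Set V) : Prop :=
  ∃ l, IsForcingList G Z l Set.univ

/-- The positive zero forcing number `Z₊(G)` (of a finite graph): the least size of a positive
zero forcing set. -/
noncomputable def positiveZeroForcingNumber {V : Type*} (G : SimpleGraph V) : ℕ :=
  sInf {m | ∃ Z : Set V, IsPositiveZeroForcingSet G Z ∧ Z.ncard = m}

/-- The forcing tree with root `r` of a chronological list `l` of forces. Its vertices are those
reached from `r` by successive forces, and its edges are the forces between them. -/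
def forcingTree {V : Type*} (G : SimpleGraph V) (l : List (V × V)) (r : V) : G.Subgraph where
  verts := {v | Relation.ReflTransGen (fun a b => (a, b) ∈ l) r v}
  Adj a b := Relation.ReflTransGen (fun a b => (a, b) ∈ l) r a ∧
    Relation.ReflTransGen (fun a b => (a, b) ∈ l) r b ∧
    G.Adj a b ∧ ((a, b) ∈ l ∨ (b, a) ∈ l)
  adj_sub h := h.2.2.1
  edge_vert h := h.1
  symm := ⟨fun _ _ h => ⟨h.2.1, h.1, h.2.2.1.symm, h.2.2.2.symm⟩⟩

/-- The set of forcing trees of the process that starts with `Z` and has the chronological list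
of forces `l`: one tree for every root in `Z`. -/
def forcingTrees {V : Type*} (G : SimpleGraph V) (Z : Set V) (l : List (V × V)) :
    Set G.Subgraph :=
  forcingTree G l '' Z

end OuterplanarForcing

/-! Partitions into induced trees are encoded by colourings `c` whose classes are connected and
whose monochromatic edges are bridges of their class. In any positive zero forcing process, when u
forces w, the edge uw is the only edge between the classes rooted at u and at w. Hence merging these
classes keeps them induced trees, and T(G) ≤ Z₊(G) holds for every finite graph.

For the converse, outerplanarity enters only through `IsOuterplanar.not_hasApexModel`: there is no
`K₄` minor with a one-vertex branch set. If such a graph has an edge, a longest path argument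
(`hasApexModel_of_three_neighbors`) yields a non-isolated vertex z whose neighbours are all among
two vertices x, y. If z is alone in its class, isolate it and keep it black throughout. Otherwise
suppress z, replacing the path xzy by an edge xy. Both operations keep the excluded minor absent and
reduce the number of edges. A process for the smaller graph lifts back: a force along xy becomes two
forces through z, and if there is none, x forces z at the end. By induction
(`exists_isForcingList_of_classAcyclic`) every tree covering, minimum or not, is the set of forcing
trees of a process with one root per tree. This gives both claims.

The topological part excludes the minor. Take arcs from the apex v to the three other branch sets.
Two of them, closed up by the drawing of their branch sets, form a closed curve separating the end
of the third, angularly middle arc from the part of the outer face near v. The Jordan curve theorem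
is replaced by a winding number, written as a sum of logarithms: it is constant on connected sets
off the curve, yet changes by one between the two sides at v (`false_of_arg_lt`). -/

namespace OuterplanarForcing

open Relation

/-! ### Walks inside colour classes and inside the white part. -/

section Reachability

variable {V : Type*} {ι : Type*}

/-- A step along an edge of `G` inside a colour class of `c`. -/
def MonoStep (G : SimpleGraph V) (c : V → ι) (a b : V) : Prop :=
  G.Adj a b ∧ c a = c b

/-- A step along an edge of `G` outside the set `B` of black vertices. -/
def WhiteStep (G : SimpleGraph V) (B : Set V) (a b : V) : Prop :=
  G.Adj a b ∧ a ∉ B ∧ b ∉ B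

/-- Every colour class of `c` is connected. -/
def ClassConnected (G : SimpleGraph V) (c : V → ι) : Prop :=
  ∀ a b, c a = c b → ReflTransGen (MonoStep G c) a b

/-- Every edge inside a colour class of `c` is a bridge of this class. -/
def ClassAcyclic (G : SimpleGraph V) (c : V → ι) : Prop :=
  ∀ a b, G.Adj a b → c a = c b →
    ¬ ReflTransGen (fun s t => MonoStep G c s t ∧ s(s, t) ≠ s(a, b)) a b

theorem reflTransGen_symm {r : V → V → Prop} (hr : ∀ a b, r a b → r b a) {a b : V}
    (h : ReflTransGen r a b) : ReflTransGen r b a := by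
  induction h with
  | refl => exact .refl
  | tail _ hbc ih => exact .head (hr _ _ hbc) ih

/-- Chains avoiding the step onto `z` by shortcuts. -/
theorem reflTransGen_shortcut {r r' : V → V → Prop} {z : V}
    (h1 : ∀ a b, a ≠ z → b ≠ z → r a b → r' a b)
    (h2 : ∀ a b, a ≠ z → r a z → r z b → a = b ∨ r' a b) (hz : ¬ r z z)
    {a d : V} (ha : a ≠ z) (hd : d ≠ z) (h : ReflTransGen r a d) : ReflTransGen r' a d := by
  suffices H : (d ≠ z → ReflTransGen r' a d) ∧ (d = z → ∀ n, r z n → ReflTransGen r' a n) from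
    H.1 hd
  clear hd
  induction h with
  | refl => exact ⟨fun _ => .refl, fun h => absurd h ha⟩
  | @tail s t hs hst ih =>
    refine ⟨fun ht => ?_, ?_⟩
    · by_cases hsz : s = z
      · subst hsz; exact ih.2 rfl t hst
      · exact (ih.1 hsz).tail (h1 _ _ hsz ht hst)
    · rintro rfl n hn
      have hsz : s ≠ t := by rintro rfl; exact hz hst
      rcases h2 s n hsz hst hn with rfl | h
      · exact ih.1 hsz
      · exact (ih.1 hsz).tail h

theorem whiteStep_symm {G : SimpleGraph V} {B : Set V} (a b : V) (h : WhiteStep G B a b) :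
    WhiteStep G B b a := ⟨h.1.symm, h.2.2, h.2.1⟩

theorem monoStep_symm {G : SimpleGraph V} {c : V → ι} (a b : V) (h : MonoStep G c a b) :
    MonoStep G c b a := ⟨h.1.symm, h.2.symm⟩

theorem reachable_induce_compl_iff {G : SimpleGraph V} {B : Set V} (a b : (Bᶜ : Set V)) :
    (G.induce Bᶜ).Reachable a b ↔ ReflTransGen (WhiteStep G B) a b := by
  rw [SimpleGraph.reachable_iff_reflTransGen]
  constructor
  · intro h
    exact ReflTransGen.lift Subtype.val (fun s t hst => ⟨hst, s.2, t.2⟩) _ _ h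
  · intro h
    obtain ⟨b, hb⟩ := b
    change ReflTransGen (WhiteStep G B) a b at h
    induction h with
    | refl => exact .refl
    | @tail s t hs hst ih => exact (ih hst.2.1).tail (by exact hst.1)

/-- Components of the white graph are replaced by reachability along white steps, the form used in
all later arguments. -/
theorem forces_iff {G : SimpleGraph V} {B : Set V} {u w : V} :
    Forces G B u w ↔ u ∈ B ∧ w ∉ B ∧ G.Adj u w ∧
      ∀ w', w' ∉ B → G.Adj u w' → ReflTransGen (WhiteStep G B) w w' → w' = w := by
  constructor
  · rintro ⟨hu, C, hC⟩
    have hw : w ∈ G.neighborSet u ∩ (Subtype.val '' C.supp) := by rw [hC]; rfl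
    obtain ⟨huw, ⟨w, hwB⟩, hwC, rfl⟩ := hw
    refine ⟨hu, hwB, huw, fun w' hw' huw' hr => ?_⟩
    have : w' ∈ G.neighborSet u ∩ (Subtype.val '' C.supp) := by
      refine ⟨huw', ⟨w', hw'⟩, ?_, rfl⟩
      rw [SimpleGraph.ConnectedComponent.mem_supp_iff] at hwC ⊢
      rw [← hwC, SimpleGraph.ConnectedComponent.eq]
      exact ((reachable_induce_compl_iff ⟨w, hwB⟩ ⟨w', hw'⟩).2 hr).symm
    rw [hC] at this
    exact this
  · rintro ⟨hu, hw, huw, h⟩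
    refine ⟨hu, (G.induce Bᶜ).connectedComponentMk ⟨w, hw⟩, ?_⟩
    ext w'
    constructor
    · rintro ⟨h1, ⟨w', hw'⟩, hC, rfl⟩
      rw [SimpleGraph.ConnectedComponent.mem_supp_iff, SimpleGraph.ConnectedComponent.eq] at hC
      exact h w' hw' h1 ((reachable_induce_compl_iff _ _).1 hC.symm)
    · rintro rfl
      exact ⟨huw, ⟨w', hw⟩, rfl, rfl⟩

end Reachability

/-! ### Tree coverings as colourings. -/

section TreeCoverings

variable {V : Type*} {ι : Type*}

/-- The subgraph induced by the colour class of `k`. -/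
def classSubgraph (G : SimpleGraph V) (c : V → ι) (k : ι) : G.Subgraph :=
  (⊤ : G.Subgraph).induce {v | c v = k}

theorem isTree_classSubgraph {G : SimpleGraph V} {c : V → ι} (hc : ClassConnected G c)
    (ha : ClassAcyclic G c) (v : V) : (classSubgraph G c (c v)).coe.IsTree := by
  have hadj : ∀ s t : (classSubgraph G c (c v)).verts,
      (classSubgraph G c (c v)).coe.Adj s t ↔ G.Adj s t := by
    rintro ⟨s, hs⟩ ⟨t, ht⟩
    simp only [classSubgraph, SimpleGraph.Subgraph.coe_adj, SimpleGraph.Subgraph.induce_adj,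
      SimpleGraph.Subgraph.top_adj]
    exact ⟨fun h => h.2.2, fun h => ⟨hs, ht, h⟩⟩
  have hmem : ∀ s : (classSubgraph G c (c v)).verts, c s = c v := fun s => s.2
  have : Nonempty (classSubgraph G c (c v)).verts := ⟨⟨v, rfl⟩⟩
  refine ⟨⟨?_⟩, ?_⟩
  · rintro a ⟨b, hb⟩
    rw [SimpleGraph.reachable_iff_reflTransGen]
    have h := hc a b ((hmem a).trans (hmem ⟨b, hb⟩).symm)
    induction h with
    | refl => exact .refl
    | @tail s t hs hst ih =>
      have hs' : c s = c v := hst.2.trans hb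
      exact (ih hs').tail ((hadj ⟨s, hs'⟩ ⟨t, hb⟩).2 hst.1)
  · rw [SimpleGraph.isAcyclic_iff_forall_adj_isBridge]
    intro a b hab
    rw [SimpleGraph.isBridge_iff, SimpleGraph.reachable_iff_reflTransGen]
    intro h
    refine ha a b ((hadj a b).1 hab) ((hmem a).trans (hmem b).symm) ?_
    refine ReflTransGen.lift Subtype.val (fun s t hst => ?_) _ _ h
    rw [SimpleGraph.deleteEdges_adj] at hst
    refine ⟨⟨(hadj s t).1 hst.1, (hmem s).trans (hmem t).symm⟩, fun he => hst.2 ?_⟩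
    have : Sym2.map Subtype.val s(s, t) = Sym2.map Subtype.val s(a, b) := he
    exact Sym2.map.injective Subtype.val_injective this

theorem isTreeCovering_range_classSubgraph {G : SimpleGraph V} {c : V → ι}
    (hc : ClassConnected G c) (ha : ClassAcyclic G c) :
    IsTreeCovering G (Set.range fun v => classSubgraph G c (c v)) where
  isInduced := by
    rintro _ ⟨v, rfl⟩
    intro a ha b hb hab
    simp only [classSubgraph, SimpleGraph.Subgraph.induce_adj, SimpleGraph.Subgraph.top_adj]
    exact ⟨ha, hb, hab⟩
  isTree := by
    rintro _ ⟨v, rfl⟩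
    exact isTree_classSubgraph hc ha v
  disjoint := by
    rintro _ ⟨v, rfl⟩ _ ⟨w, rfl⟩ hne
    refine Set.disjoint_left.2 fun x hx hx' => hne ?_
    have h1 : c x = c v := hx
    have h2 : c x = c w := hx'
    simp only [← h1, ← h2]
  covers := fun v => ⟨_, ⟨v, rfl⟩, (rfl : c v = c v)⟩

/-- The member of a tree covering that contains a given vertex. -/
noncomputable def IsTreeCovering.part {G : SimpleGraph V} {𝒯 : Set G.Subgraph}
    (h : IsTreeCovering G 𝒯) (v : V) : G.Subgraph := (h.covers v).choose

theorem IsTreeCovering.part_mem {G : SimpleGraph V} {𝒯 : Set G.Subgraph}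
    (h : IsTreeCovering G 𝒯) (v : V) : h.part v ∈ 𝒯 := (h.covers v).choose_spec.1

theorem IsTreeCovering.mem_part {G : SimpleGraph V} {𝒯 : Set G.Subgraph}
    (h : IsTreeCovering G 𝒯) (v : V) : v ∈ (h.part v).verts := (h.covers v).choose_spec.2

theorem IsTreeCovering.part_eq_iff {G : SimpleGraph V} {𝒯 : Set G.Subgraph}
    (h : IsTreeCovering G 𝒯) {H : G.Subgraph} (hH : H ∈ 𝒯) {v : V} :
    h.part v = H ↔ v ∈ H.verts := by
  constructor
  · rintro rfl; exact h.mem_part v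
  · intro hv
    by_contra hne
    exact Set.disjoint_left.1 (h.disjoint (h.part_mem v) hH hne) (h.mem_part v) hv

theorem IsTreeCovering.classConnected {G : SimpleGraph V} {𝒯 : Set G.Subgraph}
    (h : IsTreeCovering G 𝒯) : ClassConnected G h.part := by
  intro a b hab
  have hT := h.isTree _ (h.part_mem a)
  have hb : b ∈ (h.part a).verts := hab ▸ h.mem_part b
  have hr := hT.connected.preconnected ⟨a, h.mem_part a⟩ ⟨b, hb⟩
  rw [SimpleGraph.reachable_iff_reflTransGen] at hr
  refine ReflTransGen.lift Subtype.val (fun s t hst => ⟨(h.part a).adj_sub hst, ?_⟩) _ _ hr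
  rw [(h.part_eq_iff (h.part_mem a)).2 s.2, (h.part_eq_iff (h.part_mem a)).2 t.2]

theorem IsTreeCovering.classAcyclic {G : SimpleGraph V} {𝒯 : Set G.Subgraph}
    (h : IsTreeCovering G 𝒯) : ClassAcyclic G h.part := by
  intro a b hab hc hr
  have hT := h.isTree _ (h.part_mem a)
  have hI := h.isInduced _ (h.part_mem a)
  have ha : a ∈ (h.part a).verts := h.mem_part a
  have hb : b ∈ (h.part a).verts := hc ▸ h.mem_part b
  have hbr := SimpleGraph.isAcyclic_iff_forall_adj_isBridge.1 hT.isAcyclic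
    (v := ⟨a, ha⟩) (w := ⟨b, hb⟩) (hI ha hb hab)
  rw [SimpleGraph.isBridge_iff, SimpleGraph.reachable_iff_reflTransGen] at hbr
  apply hbr
  clear hbr
  suffices H : ∀ d (hd : d ∈ (h.part a).verts),
      ReflTransGen (fun s t => MonoStep G h.part s t ∧ s(s, t) ≠ s(a, b)) a d →
      ReflTransGen ((h.part a).coe.deleteEdges {s(⟨a, ha⟩, ⟨b, hb⟩)}).Adj ⟨a, ha⟩ ⟨d, hd⟩ from
    H b hb hr
  intro d hd hr
  induction hr with
  | refl => exact .refl
  | @tail s t hs hst ih =>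
    have hs' : s ∈ (h.part a).verts := by
      rw [← h.part_eq_iff (h.part_mem a)] at hd ⊢
      exact hst.1.2.trans hd
    refine (ih hs').tail ?_
    rw [SimpleGraph.deleteEdges_adj]
    refine ⟨hI hs' hd hst.1.1, fun he => hst.2 ?_⟩
    have := congrArg (Sym2.map Subtype.val) (Set.mem_singleton_iff.1 he)
    simpa using this

end TreeCoverings

/-! ### The inequality T(G) ≤ Z₊(G). -/

section LowerBound

variable {V : Type*}

/-- Merging two colour classes that are joined by a single edge preserves acyclicity. -/
theorem ClassAcyclic.merge [DecidableEq V] {G : SimpleGraph V} {c : V → V} (h : ClassAcyclic G c)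
    {u w : V} (huw : u ≠ w) (hu : c u = u) (hw : c w = w)
    (hcross : ∀ s t, G.Adj s t → c s = w → c t = u → s = w ∧ t = u) :
    ClassAcyclic G (fun v => if c v = w then u else c v) := by
  have hmono : ∀ s t, MonoStep G (fun v => if c v = w then u else c v) s t →
      c s = c t ∨ (s = w ∧ t = u) ∨ (s = u ∧ t = w) := by
    rintro s t ⟨hst, hc⟩
    by_cases hs : c s = w <;> by_cases ht : c t = w <;> simp only [hs, ht, if_true, if_false] at hc
    · exact .inl (hs.trans ht.symm)
    · exact .inr (.inl (hcross s t hst hs hc.symm))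
    · exact .inr (.inr (hcross t s hst.symm ht hc).symm)
    · exact .inl hc
  intro a b hab hc hr
  by_cases hcab : c a = c b
  -- At most one end of uw lies in the class of a; call it p. Retracting everything outside that
  -- class to p turns the walk from a to b into a walk inside the class, still avoiding ab.
  · obtain ⟨p, hp⟩ : ∃ p, ∀ s, (s = u ∨ s = w) → c s = c a → s = p := by
      by_cases hcu : c u = c a
      · refine ⟨u, ?_⟩
        rintro s (rfl | rfl) hs
        · rfl
        · exact (huw (by rw [← hu, ← hw, hcu, hs])).elim
      · refine ⟨w, ?_⟩
        rintro s (rfl | rfl) hs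
        · exact (hcu hs).elim
        · rfl
    suffices H : ∀ d, ReflTransGen (fun s t =>
        MonoStep G (fun v => if c v = w then u else c v) s t ∧ s(s, t) ≠ s(a, b)) a d →
        ReflTransGen (fun s t => MonoStep G c s t ∧ s(s, t) ≠ s(a, b)) a
          (if c d = c a then d else p) by
      have := H b hr
      rw [if_pos hcab.symm] at this
      exact h a b hab hcab this
    intro d hd
    induction hd with
    | refl => rw [if_pos rfl]
    | @tail s t hs hst ih =>
      rcases hmono s t hst.1 with he | he
      · by_cases hsa : c s = c a
        · rw [if_pos hsa] at ih
          rw [if_pos (he ▸ hsa)]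
          exact ih.tail ⟨⟨hst.1.1, he⟩, hst.2⟩
        · rw [if_neg hsa] at ih
          rwa [if_neg (he ▸ hsa)]
      · have hs' : s = u ∨ s = w := by tauto
        have ht' : t = u ∨ t = w := by tauto
        have e1 : (if c s = c a then s else p) = p := by
          split_ifs with h1
          · exact hp s hs' h1
          · rfl
        have e2 : (if c t = c a then t else p) = p := by
          split_ifs with h1
          · exact hp t ht' h1
          · rfl
        rwa [e2, ← e1]
  -- Here ab is the edge uw itself, so a walk avoiding it never leaves its old class.
  · have hedge : s(a, b) = s(u, w) := by
      rcases hmono a b ⟨hab, hc⟩ with h1 | ⟨rfl, rfl⟩ | ⟨rfl, rfl⟩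
      · exact absurd h1 hcab
      · exact Sym2.eq_swap
      · rfl
    have : ∀ d, ReflTransGen (fun s t =>
        MonoStep G (fun v => if c v = w then u else c v) s t ∧ s(s, t) ≠ s(a, b)) a d →
        c a = c d := by
      intro d hd
      induction hd with
      | refl => rfl
      | @tail s t hs hst ih =>
        rcases hmono s t hst.1 with he | ⟨rfl, rfl⟩ | ⟨rfl, rfl⟩
        · exact ih.trans he
        · exact (hst.2 (hedge ▸ Sym2.eq_swap)).elim
        · exact (hst.2 hedge.symm).elim
    exact hcab (this b hr)

/-- The partition of the vertices into forcing trees. -/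
theorem IsForcingList.exists_classAcyclic {G : SimpleGraph V} {B B' : Set V} {l : List (V × V)}
    (h : IsForcingList G B l B') (hB' : B' = Set.univ) :
    ∃ c : V → V, (∀ v, c v ∈ B) ∧ (∀ b ∈ B, c b = b) ∧
      (∀ v, ReflTransGen (MonoStep G c) (c v) v) ∧ ClassAcyclic G c ∧
      ∀ v, v ∉ B → ∃ n, n ∉ B ∧ G.Adj (c v) n ∧ ReflTransGen (WhiteStep G B) n v := by
  classical
  -- The induction runs from the first force. The last clause is what it needs: every white vertex
  -- shares a white component with a white neighbour of its root.
  induction h with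
  | nil B =>
    subst hB'
    exact ⟨id, fun _ => trivial, fun _ _ => rfl, fun _ => .refl,
      fun a b hab hc => (hab.ne hc).elim, fun v hv => (hv trivial).elim⟩
  | @cons B B' u w l hf hl ih =>
    obtain ⟨c, hcB, hcb, hconn, hac, hreach⟩ := ih hB'
    obtain ⟨huB, hwB, huw, huniq⟩ := forces_iff.1 hf
    have hne : u ≠ w := huw.ne
    have hcu : c u = u := hcb u (Set.mem_insert_of_mem _ huB)
    have hcw : c w = w := hcb w (Set.mem_insert _ _)
    have hwhite : ∀ s t, WhiteStep G (insert w B) s t → WhiteStep G B s t := fun s t hst =>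
      ⟨hst.1, fun h => hst.2.1 (Set.mem_insert_of_mem _ h),
        fun h => hst.2.2 (Set.mem_insert_of_mem _ h)⟩
    have hcw_reach : ∀ s, c s = w → ReflTransGen (WhiteStep G B) w s := by
      intro s hs
      by_cases hsw : s = w
      · rw [hsw]
      · obtain ⟨n, hn, hwn, hns⟩ := hreach s (fun h => hsw ((hcb s h).symm.trans hs))
        rw [hs] at hwn
        exact .head ⟨hwn, hwB, fun h => hn (Set.mem_insert_of_mem _ h)⟩
          (ReflTransGen.mono hwhite _ _ hns)
    have hcw_not : ∀ s, c s = w → s ∉ B := by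
      intro s hs hsB
      have := hcb s (Set.mem_insert_of_mem _ hsB)
      exact hwB (by rwa [← hs, this])
    -- A second edge between the two classes would put another white neighbour of u into the
    -- component of w, against the colour change rule.
    have hcross : ∀ s t, G.Adj s t → c s = w → c t = u → s = w ∧ t = u := by
      intro s t hst hs ht
      by_cases htu : t = u
      · subst htu
        exact ⟨huniq s (hcw_not s hs) hst.symm (hcw_reach s hs), rfl⟩
      · exfalso
        have htB : t ∉ insert w B := fun h => htu ((hcb t h).symm.trans ht)
        obtain ⟨n, hn, hun, hnt⟩ := hreach t htB
        rw [ht] at hun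
        refine hn (Set.mem_insert_iff.2 (.inl (huniq n
          (fun h => hn (Set.mem_insert_of_mem _ h)) hun ?_)))
        exact ((hcw_reach s hs).tail
          ⟨hst, hcw_not s hs, fun h => htB (Set.mem_insert_of_mem _ h)⟩).trans
          (reflTransGen_symm whiteStep_symm (ReflTransGen.mono hwhite _ _ hnt))
    have hmono : ∀ s t, MonoStep G c s t →
        MonoStep G (fun v => if c v = w then u else c v) s t :=
      fun s t hst => ⟨hst.1, by simp only [hst.2]⟩
    refine ⟨fun v => if c v = w then u else c v, fun v => ?_, fun b hb => ?_, fun v => ?_,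
      hac.merge hne hcu hcw hcross, fun v hv => ?_⟩
    · dsimp only
      split_ifs with h
      · exact huB
      · exact (Set.mem_insert_iff.1 (hcB v)).resolve_left h
    · have : c b = b := hcb b (Set.mem_insert_of_mem _ hb)
      dsimp only
      rw [this, if_neg]
      rintro rfl
      exact hwB hb
    · have := ReflTransGen.mono hmono _ _ (hconn v)
      dsimp only
      split_ifs with h
      · rw [h] at this
        refine .head ⟨huw, ?_⟩ this
        simp only [hcu, hcw, if_neg hne, if_true]
      · exact this
    · dsimp only
      split_ifs with h
      · exact ⟨w, hwB, huw, hcw_reach v h⟩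
      · have hvB : v ∉ insert w B := by
          rintro (rfl | h')
          · exact h hcw
          · exact hv h'
        obtain ⟨n, hn, h1, h2⟩ := hreach v hvB
        exact ⟨n, fun h => hn (Set.mem_insert_of_mem _ h), h1, ReflTransGen.mono hwhite _ _ h2⟩

theorem IsPositiveZeroForcingSet.exists_isTreeCovering [Finite V] {G : SimpleGraph V} {Z : Set V}
    (h : IsPositiveZeroForcingSet G Z) :
    ∃ 𝒯 : Set G.Subgraph, IsTreeCovering G 𝒯 ∧ 𝒯.ncard ≤ Z.ncard := by
  obtain ⟨l, hl⟩ := h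
  obtain ⟨c, hcB, -, hconn, hac, -⟩ := hl.exists_classAcyclic rfl
  have hcc : ClassConnected G c := fun a b hab =>
    (reflTransGen_symm monoStep_symm (hconn a)).trans (hab ▸ hconn b)
  refine ⟨_, isTreeCovering_range_classSubgraph hcc hac, ?_⟩
  have hsub : (Set.range fun v => classSubgraph G c (c v)) ⊆ classSubgraph G c '' Z := by
    rintro _ ⟨v, rfl⟩
    exact ⟨c v, hcB v, rfl⟩
  exact (Set.ncard_le_ncard hsub (Set.toFinite _)).trans (Set.ncard_image_le Z.toFinite)

end LowerBound

/-! ### Suppressing a vertex with at most two neighbours. -/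

section Suppression

variable {V : Type*} {ι : Type*}

/-- The graph `G` with the vertex `z` isolated and the edge `xy` added (if `x ≠ y`). -/
def suppress (G : SimpleGraph V) (z x y : V) : SimpleGraph V where
  Adj a b := a ≠ b ∧ a ≠ z ∧ b ≠ z ∧ (G.Adj a b ∨ (a = x ∧ b = y) ∨ (a = y ∧ b = x))
  symm := ⟨by
    rintro a b ⟨h1, h2, h3, h4⟩
    refine ⟨h1.symm, h3, h2, ?_⟩
    rcases h4 with h | h | h
    · exact .inl h.symm
    · exact .inr (.inr h.symm)
    · exact .inr (.inl h.symm)⟩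
  loopless := ⟨fun _ h => h.1 rfl⟩

variable {G : SimpleGraph V} {z x y : V}

theorem suppress_comm (G : SimpleGraph V) (z x y : V) : suppress G z x y = suppress G z y x := by
  ext a b
  simp only [suppress]
  tauto

theorem IsForcingList.adj_of_mem {B B' : Set V} {l : List (V × V)} (h : IsForcingList G B l B') :
    ∀ p ∈ l, G.Adj p.1 p.2 := by
  induction h with
  | nil B => simp
  | cons hf _ ih =>
    intro p hp
    rcases List.mem_cons.1 hp with rfl | hp
    · exact (forces_iff.1 hf).2.2.1
    · exact ih p hp

/-- The two graphs differ only in edges with a black end: those at z, and the edge xy, whose ends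
are both black and which therefore carries no force. -/
theorem Forces.of_suppress_of_mem {B : Set V} (hz : z ∈ B) (hxy : x = y ∨ (x ∈ B ∧ y ∈ B))
    {u w : V} (h : Forces (suppress G z x y) B u w) : Forces G B u w := by
  rw [forces_iff] at h ⊢
  obtain ⟨hu, hw, huw, h⟩ := h
  refine ⟨hu, hw, ?_, fun w' hw' huw' hr => ?_⟩
  · rcases huw.2.2.2 with h1 | ⟨rfl, rfl⟩ | ⟨rfl, rfl⟩
    · exact h1
    · exact (hxy.elim huw.1 fun h => hw h.2).elim
    · exact (hxy.elim huw.1.symm fun h => hw h.1).elim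
  · refine h w' hw' ⟨huw'.ne, huw.2.1, fun h => hw' (h ▸ hz), .inl huw'⟩ ?_
    refine ReflTransGen.mono (fun s t hst => ?_) _ _ hr
    exact ⟨⟨hst.1.ne, fun h => hst.2.1 (h ▸ hz), fun h => hst.2.2 (h ▸ hz), .inl hst.1⟩, hst.2⟩

theorem IsForcingList.of_suppress_of_mem {B B' : Set V} {l : List (V × V)}
    (h : IsForcingList (suppress G z x y) B l B') (hz : z ∈ B)
    (hxy : x = y ∨ (x ∈ B ∧ y ∈ B)) : IsForcingList G B l B' := by
  induction h with
  | nil B => exact .nil B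
  | cons h hl ih =>
    exact .cons (h.of_suppress_of_mem hz hxy) (ih (Set.mem_insert_of_mem _ hz)
      (hxy.imp_right fun h => ⟨Set.mem_insert_of_mem _ h.1, Set.mem_insert_of_mem _ h.2⟩))

/-- A white walk passing through z enters and leaves by x or y, so it can use the new edge instead.
-/
theorem whiteReach_suppress (hN : ∀ n, G.Adj z n → n = x ∨ n = y) {B : Set V} {a b : V}
    (ha : a ≠ z) (hb : b ≠ z) (h : ReflTransGen (WhiteStep G (B \ {z})) a b) :
    ReflTransGen (WhiteStep (suppress G z x y) B) a b := by
  have hB : ∀ s, s ≠ z → s ∉ B \ {z} → s ∉ B := fun s hs h hsB => h ⟨hsB, hs⟩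
  refine reflTransGen_shortcut (fun s t hs ht hst => ?_) (fun s t hs hsz hzt => ?_) ?_ ha hb h
  · exact ⟨⟨hst.1.ne, hs, ht, .inl hst.1⟩, hB _ hs hst.2.1, hB _ ht hst.2.2⟩
  · by_cases hst : s = t
    · exact .inl hst
    · have ht : t ≠ z := hzt.1.ne'
      refine .inr ⟨⟨hst, hs, ht, .inr ?_⟩, hB _ hs hsz.2.1, hB _ ht hzt.2.2⟩
      rcases hN s hsz.1.symm with rfl | rfl <;> rcases hN t hzt.1 with rfl | rfl <;> tauto
  · exact fun h => h.1.ne rfl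

/-- Only z could spoil the force when it is white again. Then u is one of x, y, and the walk from w
to z reaches z through the other one, which is a neighbour of u along the new edge. It must be w, so
the force runs along xy, which is excluded. -/
theorem Forces.of_suppress (hzx : G.Adj z x) (hzy : G.Adj z y)
    (hN : ∀ n, G.Adj z n → n = x ∨ n = y) {B : Set V} (hz : z ∈ B) {u w : V}
    (h : Forces (suppress G z x y) B u w) (h1 : ¬ (u = x ∧ w = y)) (h2 : ¬ (u = y ∧ w = x)) :
    Forces G (B \ {z}) u w := by
  rw [forces_iff] at h ⊢
  obtain ⟨hu, hw, huw, h⟩ := h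
  have hwz : w ≠ z := huw.2.2.1
  refine ⟨⟨hu, huw.2.1⟩, fun h => hw h.1, by have := huw.2.2.2; tauto, fun w' hw' huw' hr => ?_⟩
  by_cases hw'z : w' = z
  · subst hw'z
    exfalso
    obtain rfl | ⟨n, hwn, hnz⟩ := hr.cases_tail
    · exact hwz rfl
    have hnz' : n ≠ w' := hnz.1.ne
    have hnB : n ∉ B := fun h => hnz.2.1 ⟨h, hnz'⟩
    have hun : u ≠ n := fun h => hnB (h ▸ hu)
    have hr' := whiteReach_suppress hN hwz hnz' hwn
    have hu' := hN u huw'.symm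
    have hn' := hN n hnz.1.symm
    have hadj : (suppress G w' x y).Adj u n := by
      refine ⟨hun, huw.2.1, hnz', .inr ?_⟩
      rcases hu' with rfl | rfl <;> rcases hn' with rfl | rfl <;> tauto
    have := h n hnB hadj hr'
    subst this
    rcases hu' with rfl | rfl <;> rcases hn' with rfl | rfl <;> tauto
  · have hw'B : w' ∉ B := fun h => hw' ⟨h, hw'z⟩
    exact h w' hw'B ⟨huw'.ne, huw.2.1, hw'z, .inl huw'⟩ (whiteReach_suppress hN hwz hw'z hr)

/-- Non-adjacency of x and y in `G` matters: otherwise x would see both z and y in one white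
component and could not force z. -/
theorem Forces.subdivide (hzx : G.Adj z x) (hzy : G.Adj z y)
    (hN : ∀ n, G.Adj z n → n = x ∨ n = y) (hxy : ¬ G.Adj x y) {B : Set V} (hz : z ∈ B)
    (h : Forces (suppress G z x y) B x y) :
    Forces G (B \ {z}) x z ∧ Forces G B z y := by
  simp only [forces_iff] at h ⊢
  obtain ⟨hx, hy, -, h⟩ := h
  refine ⟨⟨⟨hx, hzx.ne'⟩, fun h => h.2 rfl, hzx.symm, fun w' hw' hxw' hr => ?_⟩,
    ⟨hz, hy, hzy, fun w' hw' hzw' _ => ?_⟩⟩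
  · by_contra hne
    have hw'B : w' ∉ B := fun h => hw' ⟨h, hne⟩
    have hr' : ReflTransGen (WhiteStep G (B \ {z})) y w' :=
      .head ⟨hzy.symm, fun h => hy h.1, fun h => h.2 rfl⟩ hr
    have := h w' hw'B ⟨hxw'.ne, hzx.ne', hne, .inl hxw'⟩
      (whiteReach_suppress hN hzy.ne' hne hr')
    subst this
    exact hxy hxw'
  · rcases hN w' hzw' with rfl | rfl
    · exact (hw' hx).elim
    · rfl

/-- The colouring `c`, with a new colour for the vertex `z`. -/
noncomputable def recolor (c : V → ι) (z : V) (v : V) : Option ι :=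
  open Classical in if v = z then none else some (c v)

theorem recolor_self (c : V → ι) (z : V) : recolor c z z = none := if_pos rfl

theorem recolor_of_ne (c : V → ι) {z v : V} (h : v ≠ z) : recolor c z v = some (c v) := if_neg h

theorem recolor_eq_iff {c : V → ι} {z a b : V} (ha : a ≠ z) (hb : b ≠ z) :
    recolor c z a = recolor c z b ↔ c a = c b := by
  rw [recolor_of_ne c ha, recolor_of_ne c hb, Option.some_inj]

theorem eq_of_recolor_eq {c : V → ι} {z a : V} (h : recolor c z a = recolor c z z) : a = z := by
  by_contra hne
  rw [recolor_self, recolor_of_ne c hne] at h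
  exact absurd h (by simp)

theorem ClassConnected.suppress {c : V → ι} (hc : ClassConnected G c)
    (h : ∀ a b, G.Adj z a → G.Adj z b → c a = c z → c b = c z → a = b ∨
      (a = x ∧ b = y) ∨ (a = y ∧ b = x)) :
    ClassConnected (suppress G z x y) (recolor c z) := by
  intro a b hab
  by_cases ha : a = z
  · subst ha
    rw [eq_of_recolor_eq hab.symm]
  by_cases hb : b = z
  · subst hb
    exact (ha (eq_of_recolor_eq hab)).elim
  refine reflTransGen_shortcut (fun s t hs ht hst => ?_) (fun s t hs hsz hzt => ?_) ?_ ha hb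
    (hc a b ((recolor_eq_iff ha hb).1 hab))
  · exact ⟨⟨hst.1.ne, hs, ht, .inl hst.1⟩, (recolor_eq_iff hs ht).2 hst.2⟩
  · have ht : t ≠ z := hzt.1.ne'
    by_cases hst : s = t
    · exact .inl hst
    · exact .inr ⟨⟨hst, hs, ht, .inr ((h s t hsz.1.symm hzt.1 hsz.2 hzt.2.symm).resolve_left hst)⟩,
        (recolor_eq_iff hs ht).2 (hsz.2.trans hzt.2)⟩
  · exact fun h => h.1.ne rfl

/-- When xy is a monochromatic new edge, z had the same colour, so xy stands for the path xzy. A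
bypass in the suppressed graph pulls back through z to a bypass in `G`. -/
theorem ClassAcyclic.suppress {c : V → ι} (hc : ClassAcyclic G c) (hzx : G.Adj z x)
    (hzy : G.Adj z y) (hxy : c x = c y → x = y ∨ c z = c x) :
    ClassAcyclic (suppress G z x y) (recolor c z) := by
  rintro a b ⟨hab, ha, hb, hadj⟩ hcab hr
  rw [recolor_eq_iff ha hb] at hcab
  have hmono : ∀ s t, MonoStep (OuterplanarForcing.suppress G z x y) (recolor c z) s t →
      c s = c t := fun s t hst => (recolor_eq_iff hst.1.2.1 hst.1.2.2.1).1 hst.2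
  have hav : ∀ s t, s = z ∨ t = z → s(s, t) ≠ s(a, b) := by
    rintro s t h he
    rcases Sym2.eq_iff.1 he with ⟨rfl, rfl⟩ | ⟨rfl, rfl⟩ <;> tauto
  by_cases hG : G.Adj a b
  · refine hc a b hG hcab ?_
    refine reflTransGen_closed (fun s t hst => ?_) _ _ hr
    have hcst := hmono s t hst.1
    rcases hst.1.1.2.2.2 with h | ⟨rfl, rfl⟩ | ⟨rfl, rfl⟩
    · exact .single ⟨⟨h, hcst⟩, hst.2⟩
    · have := (hxy hcst).resolve_left hst.1.1.1
      exact .tail (.single ⟨⟨hzx.symm, this.symm⟩, hav _ _ (.inr rfl)⟩)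
        ⟨⟨hzy, this.trans hcst⟩, hav _ _ (.inl rfl)⟩
    · have := (hxy hcst.symm).resolve_left hst.1.1.1.symm
      exact .tail (.single ⟨⟨hzy.symm, hcst.trans this.symm⟩, hav _ _ (.inr rfl)⟩)
        ⟨⟨hzx, this⟩, hav _ _ (.inl rfl)⟩
  · replace hadj := hadj.resolve_left hG
    have hzab : G.Adj z a ∧ G.Adj z b ∧ c z = c a := by
      rcases hadj with ⟨rfl, rfl⟩ | ⟨rfl, rfl⟩
      · exact ⟨hzx, hzy, (hxy hcab).resolve_left hab⟩
      · exact ⟨hzy, hzx, ((hxy hcab.symm).resolve_left hab.symm).trans hcab.symm⟩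
    obtain ⟨hza, hzb, hcza⟩ := hzab
    refine hc a z hza.symm hcza.symm (.tail (b := b) (ReflTransGen.mono (fun s t hst => ?_) _ _ hr)
      ⟨⟨hzb.symm, hcab.symm.trans hcza.symm⟩, fun he => ?_⟩)
    · refine ⟨⟨?_, hmono s t hst.1⟩, fun he => ?_⟩
      · refine hst.1.1.2.2.2.resolve_right fun h => hst.2 ?_
        rcases hadj with ⟨rfl, rfl⟩ | ⟨rfl, rfl⟩ <;> rcases h with ⟨rfl, rfl⟩ | ⟨rfl, rfl⟩ <;>
          first | rfl | exact Sym2.eq_swap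
      · rcases Sym2.eq_iff.1 he with ⟨-, h⟩ | ⟨h, -⟩
        · exact hst.1.1.2.2.1 h
        · exact hst.1.1.2.1 h
    · rcases Sym2.eq_iff.1 he with ⟨h, -⟩ | ⟨h, -⟩
      · exact hab h.symm
      · exact hb h

/-- Lifts a process in which the isolated vertex z had to be a root to one starting without z. Up to
the first force along xy, z stays white and the forces are copied. -/
theorem IsForcingList.exists_of_suppress {c : V → ι} (hzx : G.Adj z x) (hzy : G.Adj z y)
    (hN : ∀ n, G.Adj z n → n = x ∨ n = y) (hcz : c z = c x)
    (hxy : c x = c y → ¬ G.Adj x y) {B B' : Set V} {l : List (V × V)}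
    (h : IsForcingList (suppress G z x y) B l B') (hB' : B' = Set.univ) (hz : z ∈ B)
    (hl : ∀ p ∈ l, recolor c z p.1 = recolor c z p.2) :
    ∃ l', IsForcingList G (B \ {z}) l' Set.univ ∧ ∀ p ∈ l', c p.1 = c p.2 := by
  induction h with
  | nil B =>
    subst hB'
    -- No force used xy, so z is the last white vertex and x forces it.
    refine ⟨[(x, z)], .cons (forces_iff.2 ⟨⟨trivial, hzx.ne'⟩, fun h => h.2 rfl, hzx.symm, ?_⟩) ?_,
      ?_⟩
    · intro w' hw' _ _
      by_contra hne
      exact hw' ⟨trivial, hne⟩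
    · have : insert z (Set.univ \ {z}) = Set.univ := by
        ext v; by_cases h : v = z <;> simp [h]
      rw [this]
      exact .nil _
    · simp [hcz]
  | @cons B B' u w l hf hfl ih =>
    have huw := (forces_iff.1 hf).2.2.1
    have hcl : ∀ p ∈ (u, w) :: l, c p.1 = c p.2 := fun p hp =>
      have hadj := (IsForcingList.cons hf hfl).adj_of_mem p hp
      (recolor_eq_iff hadj.2.1 hadj.2.2.1).1 (hl p hp)
    have hcuw : c u = c w := hcl (u, w) (List.mem_cons_self ..)
    have hins : insert z (B \ {z}) = B := by
      ext v; by_cases h : v = z <;> simp [h, hz]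
    by_cases h1 : u = x ∧ w = y
    · obtain ⟨rfl, rfl⟩ := h1
      obtain ⟨f1, f2⟩ := hf.subdivide hzx hzy hN (hxy hcuw) hz
      -- From here on x, y and z are all black, so the remaining list is valid in `G` verbatim.
      refine ⟨(u, z) :: (z, w) :: l, .cons f1 (.cons (hins.symm ▸ f2) ?_), ?_⟩
      · rw [hins, ← hB']
        exact hfl.of_suppress_of_mem (Set.mem_insert_of_mem _ hz)
          (.inr ⟨Set.mem_insert_of_mem _ hf.1, Set.mem_insert _ _⟩)
      · intro p hp
        simp only [List.mem_cons] at hp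
        rcases hp with rfl | rfl | hp
        · exact hcz.symm
        · exact hcz.trans hcuw
        · exact hcl p (List.mem_cons_of_mem _ hp)
    by_cases h2 : u = y ∧ w = x
    · obtain ⟨rfl, rfl⟩ := h2
      rw [suppress_comm] at hf
      obtain ⟨f1, f2⟩ := hf.subdivide hzy hzx (fun n hn => (hN n hn).symm)
        (fun h => hxy hcuw.symm h.symm) hz
      refine ⟨(u, z) :: (z, w) :: l, .cons f1 (.cons (hins.symm ▸ f2) ?_), ?_⟩
      · rw [hins, ← hB']
        exact hfl.of_suppress_of_mem (Set.mem_insert_of_mem _ hz)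
          (.inr ⟨Set.mem_insert _ _, Set.mem_insert_of_mem _ hf.1⟩)
      · intro p hp
        simp only [List.mem_cons] at hp
        rcases hp with rfl | rfl | hp
        · exact hcuw.trans hcz.symm
        · exact hcz
        · exact hcl p (List.mem_cons_of_mem _ hp)
    obtain ⟨l', hl', hcl'⟩ := ih hB' (Set.mem_insert_of_mem _ hz)
      fun p hp => hl p (List.mem_cons_of_mem _ hp)
    have hins' : insert w B \ {z} = insert w (B \ {z}) := by
      ext v
      by_cases h : v = z
      · subst h; simp [huw.2.2.1.symm]
      · simp [h]
    refine ⟨(u, w) :: l', .cons (hf.of_suppress hzx hzy hN hz h1 h2) (hins' ▸ hl'), ?_⟩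
    intro p hp
    rcases List.mem_cons.1 hp with rfl | hp
    · exact hcuw
    · exact hcl' p hp

end Suppression

/-! ### Excluding a minor `K₄` yields a vertex of small degree. -/

section CompleteMinors

variable {V : Type*} {ι : Type*}

/-- A model of `K₄` as a minor of `G` with branch sets `{v}`, `C 0`, `C 1` and `C 2`. -/
structure IsApexModel (G : SimpleGraph V) (v : V) (C : Fin 3 → Set V) : Prop where
  notMem : ∀ i, v ∉ C i
  conn : ∀ i, ∀ a ∈ C i, ∀ b ∈ C i,
    ReflTransGen (fun s t => G.Adj s t ∧ s ∈ C i ∧ t ∈ C i) a b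
  disj : ∀ i j, i ≠ j → ∀ a ∈ C i, a ∉ C j
  apex : ∀ i, ∃ a ∈ C i, G.Adj v a
  adj : ∀ i j, i ≠ j → ∃ a ∈ C i, ∃ b ∈ C j, G.Adj a b

/-- `G` has a minor `K₄` one of whose branch sets is a single vertex. -/
def HasApexModel (G : SimpleGraph V) : Prop :=
  ∃ v C, IsApexModel G v C

variable {G : SimpleGraph V} {z x y : V}

theorem IsApexModel.apex_ne {v : V} {C : Fin 3 → Set V}
    (h : IsApexModel (suppress G z x y) v C) : v ≠ z := by
  obtain ⟨a, -, ha⟩ := h.apex 0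
  exact ha.2.1

theorem IsApexModel.ne_of_mem {v : V} {C : Fin 3 → Set V}
    (h : IsApexModel (suppress G z x y) v C) {i : Fin 3} {t : V} (ht : t ∈ C i) : t ≠ z := by
  rintro rfl
  obtain ⟨a, haC, ha⟩ := h.apex i
  rcases (h.conn i t ht a haC).cases_head with rfl | ⟨s, hs, -⟩
  · exact ha.2.2.1 rfl
  · exact hs.1.2.1 rfl

/-- Add z to the branch set containing x: each use of the new edge xy is then replaced by zy,
together with xz inside the enlarged set. -/
theorem IsApexModel.of_suppress_of_mem (hzx : G.Adj z x) (hzy : G.Adj z y) {v : V}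
    {C : Fin 3 → Set V} (h : IsApexModel (suppress G z x y) v C) {i : Fin 3} (hx : x ∈ C i) :
    HasApexModel G := by
  have hC : ∀ j, ∀ t ∈ C j, t ∈ C j ∪ {t | t = z ∧ j = i} := fun j t ht => .inl ht
  have hzC : z ∈ C i ∪ {t | t = z ∧ i = i} := .inr ⟨rfl, rfl⟩
  have hidx : ∀ j, x ∈ C j → j = i := fun j hj => by
    by_contra hne
    exact h.disj j i hne x hj hx
  refine ⟨v, fun j => C j ∪ {t | t = z ∧ j = i}, ?_, ?_, ?_, ?_, ?_⟩
  · rintro j (hv | ⟨hv, -⟩)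
    · exact h.notMem j hv
    · exact h.apex_ne hv
  · have key : ∀ j, ∀ a ∈ C j, ∀ b ∈ C j, ReflTransGen (fun s t => G.Adj s t ∧
        s ∈ C j ∪ {t | t = z ∧ j = i} ∧ t ∈ C j ∪ {t | t = z ∧ j = i}) a b := by
      intro j a ha b hb
      refine reflTransGen_closed (fun s t hst => ?_) _ _ (h.conn j a ha b hb)
      obtain ⟨hst, hs, ht⟩ := hst
      rcases hst.2.2.2 with h' | ⟨rfl, rfl⟩ | ⟨rfl, rfl⟩
      · exact .single ⟨h', .inl hs, .inl ht⟩
      · obtain rfl := hidx j hs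
        exact .tail (.single ⟨hzx.symm, .inl hs, hzC⟩) ⟨hzy, hzC, .inl ht⟩
      · obtain rfl := hidx j ht
        exact .tail (.single ⟨hzy.symm, .inl hs, hzC⟩) ⟨hzx, hzC, .inl ht⟩
    rintro j a (ha | ⟨rfl, rfl⟩) b (hb | ⟨rfl, hj⟩)
    · exact key j a ha b hb
    · subst hj
      exact (key j a ha x hx).tail ⟨hzx.symm, .inl hx, hzC⟩
    · exact .head ⟨hzx, hzC, .inl hx⟩ (key j x hx b hb)
    · exact .refl
  · rintro j k hjk a (ha | ⟨rfl, rfl⟩) (hb | ⟨hb, rfl⟩)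
    · exact h.disj j k hjk a ha hb
    · exact h.ne_of_mem ha hb
    · exact h.ne_of_mem hb rfl
    · exact hjk rfl
  · intro j
    obtain ⟨a, ha, hva⟩ := h.apex j
    rcases hva.2.2.2 with h' | ⟨rfl, rfl⟩ | ⟨rfl, rfl⟩
    · exact ⟨a, .inl ha, h'⟩
    · exact (h.notMem i hx).elim
    · exact ⟨z, .inr ⟨rfl, hidx j ha⟩, hzy.symm⟩
  · intro j k hjk
    obtain ⟨a, ha, b, hb, hab⟩ := h.adj j k hjk
    rcases hab.2.2.2 with h' | ⟨rfl, rfl⟩ | ⟨rfl, rfl⟩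
    · exact ⟨a, .inl ha, b, .inl hb, h'⟩
    · exact ⟨z, .inr ⟨rfl, hidx j ha⟩, b, .inl hb, hzy⟩
    · exact ⟨a, .inl ha, z, .inr ⟨rfl, hidx k hb⟩, hzy.symm⟩

/-- Every edge used by a model has an end in some `C i`, so the new edge matters only if x or y lies
in one of these sets. -/
theorem HasApexModel.of_suppress (hzx : G.Adj z x) (hzy : G.Adj z y)
    (h : HasApexModel (suppress G z x y)) : HasApexModel G := by
  obtain ⟨v, C, h⟩ := h
  by_cases hx : ∃ i, x ∈ C i
  · obtain ⟨i, hx⟩ := hx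
    exact h.of_suppress_of_mem hzx hzy hx
  by_cases hy : ∃ i, y ∈ C i
  · obtain ⟨i, hy⟩ := hy
    rw [suppress_comm] at h
    exact h.of_suppress_of_mem hzy hzx hy
  push Not at hx hy
  have hadj : ∀ i, ∀ a ∈ C i, ∀ b, (suppress G z x y).Adj a b → G.Adj a b := by
    rintro i a ha b hab
    rcases hab.2.2.2 with h' | ⟨rfl, rfl⟩ | ⟨rfl, rfl⟩
    · exact h'
    · exact (hx i ha).elim
    · exact (hy i ha).elim
  refine ⟨v, C, h.notMem, fun i a ha b hb => ?_, h.disj, fun i => ?_, fun i j hij => ?_⟩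
  · exact ReflTransGen.mono (fun s t hst => ⟨hadj i s hst.2.1 t hst.1, hst.2⟩) _ _
      (h.conn i a ha b hb)
  · obtain ⟨a, ha, hva⟩ := h.apex i
    exact ⟨a, ha, (hadj i a ha v hva.symm).symm⟩
  · obtain ⟨a, ha, b, hb, hab⟩ := h.adj i j hij
    exact ⟨a, ha, b, hb, hadj i a ha b hab⟩

/-- The vertices `f 0, …, f n` form a path. -/
def IsPathSeq (G : SimpleGraph V) (n : ℕ) (f : ℕ → V) : Prop :=
  Set.InjOn f (Set.Iic n) ∧ ∀ i < n, G.Adj (f i) (f (i + 1))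

theorem IsPathSeq.length_lt [Finite V] {n : ℕ} {f : ℕ → V} (h : IsPathSeq G n f) :
    n < Nat.card V := by
  have h1 := h.1.ncard_image
  have h2 : (f '' Set.Iic n).ncard ≤ Nat.card V := Set.ncard_le_card _
  have h3 : (Set.Iic n).ncard = n + 1 := by
    rw [← Finset.coe_Iic, Set.ncard_coe_finset, Nat.card_Iic]
  omega

theorem IsPathSeq.cons {n : ℕ} {f : ℕ → V} (h : IsPathSeq G n f) {w : V} (hw : G.Adj w (f 0))
    (hf : ∀ j ≤ n, w ≠ f j) : IsPathSeq G (n + 1) (fun k => if k = 0 then w else f (k - 1)) := by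
  refine ⟨fun a ha b hb hab => ?_, fun i hi => ?_⟩
  · simp only [Set.mem_Iic] at ha hb
    dsimp only at hab
    split_ifs at hab with h1 h2 h2
    · omega
    · exact (hf _ (by omega) hab).elim
    · exact (hf _ (by omega) hab.symm).elim
    · have := h.1 (show a - 1 ≤ n by omega) (show b - 1 ≤ n by omega) hab
      omega
  · dsimp only
    rcases i with _ | i
    · simpa using hw
    · simpa using h.2 i (by omega)

/-- Reversal of the initial part before `f i`, for a neighbour `f i` of `f 0`. -/
theorem IsPathSeq.rotate {n : ℕ} {f : ℕ → V} (h : IsPathSeq G n f) {i : ℕ}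
    (hin : i ≤ n) (hf : G.Adj (f 0) (f i)) :
    IsPathSeq G n (fun k => if k < i then f (i - 1 - k) else f k) := by
  refine ⟨fun a ha b hb hab => ?_, fun k hk => ?_⟩
  · simp only [Set.mem_Iic] at ha hb
    dsimp only at hab
    split_ifs at hab with h1 h2 h2
    · have := h.1 (show i - 1 - a ≤ n by omega) (show i - 1 - b ≤ n by omega) hab
      omega
    · have := h.1 (show i - 1 - a ≤ n by omega) (show b ≤ n by omega) hab
      omega
    · have := h.1 (show a ≤ n by omega) (show i - 1 - b ≤ n by omega) hab
      omega
    · exact h.1 ha hb hab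
  · dsimp only
    by_cases h1 : k + 1 < i
    · rw [if_pos (by omega), if_pos h1]
      have := h.2 (i - 1 - (k + 1)) (by omega)
      rw [show i - 1 - (k + 1) + 1 = i - 1 - k by omega] at this
      exact this.symm
    · by_cases h2 : k < i
      · rw [if_pos h2, if_neg h1, show i - 1 - k = 0 by omega, show k + 1 = i by omega]
        exact hf
      · rw [if_neg h2, if_neg h1]
        exact h.2 k hk

theorem IsPathSeq.reflTransGen {n : ℕ} {f : ℕ → V} (h : IsPathSeq G n f) {p q : ℕ} (hq : q ≤ n)
    {a b : V} (ha : a ∈ f '' Set.Icc p q) (hb : b ∈ f '' Set.Icc p q) :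
    ReflTransGen (fun s t => G.Adj s t ∧ s ∈ f '' Set.Icc p q ∧ t ∈ f '' Set.Icc p q) a b := by
  have key : ∀ k, p + k ≤ q → ReflTransGen
      (fun s t => G.Adj s t ∧ s ∈ f '' Set.Icc p q ∧ t ∈ f '' Set.Icc p q) (f p) (f (p + k)) := by
    intro k
    induction k with
    | zero => exact fun _ => .refl
    | succ k ih =>
      intro hk
      exact (ih (by omega)).tail ⟨h.2 _ (by omega), ⟨p + k, ⟨by omega, by omega⟩, rfl⟩,
        ⟨p + k + 1, ⟨by omega, by omega⟩, rfl⟩⟩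
  have key' : ∀ a ∈ f '' Set.Icc p q, ReflTransGen
      (fun s t => G.Adj s t ∧ s ∈ f '' Set.Icc p q ∧ t ∈ f '' Set.Icc p q) (f p) a := by
    rintro _ ⟨k, ⟨hk1, hk2⟩, rfl⟩
    have := key (k - p) (by omega)
    rwa [show p + (k - p) = k by omega] at this
  exact (reflTransGen_symm (fun s t hst => ⟨hst.1.symm, hst.2.2, hst.2.1⟩) (key' a ha)).trans
    (key' b hb)

/-- The apex is `f 0`; the other branch sets are the path pieces from 1 to i - 1, the single vertex
`f i`, and from i + 1 to n. The chord from `f (i - 1)` joins the first piece to the last, and the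
chord to `f j` joins the apex to the last. -/
theorem IsPathSeq.hasApexModel {n : ℕ} {f : ℕ → V} (h : IsPathSeq G n f) {i j m : ℕ}
    (hi : 2 ≤ i) (hij : i < j) (hjn : j ≤ n) (him : i < m) (hmn : m ≤ n)
    (h1 : G.Adj (f 0) (f i)) (h2 : G.Adj (f 0) (f j)) (h3 : G.Adj (f (i - 1)) (f m)) :
    HasApexModel G := by
  have hdisj : ∀ p q p' q', q ≤ n → q' ≤ n → (q < p' ∨ q' < p) →
      ∀ a ∈ f '' Set.Icc p q, a ∉ f '' Set.Icc p' q' := by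
    rintro p q p' q' hq hq' hlt _ ⟨a, ⟨ha1, ha2⟩, rfl⟩ ⟨b, ⟨hb1, hb2⟩, hab⟩
    have := h.1 (show b ≤ n by omega) (show a ≤ n by omega) hab
    omega
  let lo : Fin 3 → ℕ := ![1, i, i + 1]
  let hi' : Fin 3 → ℕ := ![i - 1, i, n]
  have hhi : ∀ k, hi' k ≤ n := by
    intro k; fin_cases k
    · change i - 1 ≤ n; omega
    · change i ≤ n; omega
    · exact le_rfl
  have hadj : ∀ a b : Fin 3, a < b → ∃ s ∈ f '' Set.Icc (lo a) (hi' a),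
      ∃ t ∈ f '' Set.Icc (lo b) (hi' b), G.Adj s t := by
    have h4 := h.2 (i - 1) (by omega)
    rw [show i - 1 + 1 = i by omega] at h4
    have m1 : f (i - 1) ∈ f '' Set.Icc (lo 0) (hi' 0) :=
      ⟨i - 1, ⟨show 1 ≤ i - 1 by omega, le_rfl⟩, rfl⟩
    have m2 : f i ∈ f '' Set.Icc (lo 1) (hi' 1) := ⟨i, ⟨le_rfl, le_rfl⟩, rfl⟩
    have m3 : f (i + 1) ∈ f '' Set.Icc (lo 2) (hi' 2) :=
      ⟨i + 1, ⟨le_rfl, show i + 1 ≤ n by omega⟩, rfl⟩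
    have m4 : f m ∈ f '' Set.Icc (lo 2) (hi' 2) := ⟨m, ⟨him, hmn⟩, rfl⟩
    intro a b hab
    fin_cases a <;> fin_cases b
    all_goals first
      | exact absurd hab (by decide)
      | exact ⟨_, m1, _, m2, h4⟩
      | exact ⟨_, m1, _, m4, h3⟩
      | exact ⟨_, m2, _, m3, h.2 i (by omega)⟩
  refine ⟨f 0, fun k => f '' Set.Icc (lo k) (hi' k), ?_, ?_, ?_, ?_, ?_⟩
  · intro k hk
    refine hdisj 0 0 (lo k) (hi' k) (Nat.zero_le _) (hhi k) (.inl ?_) (f 0)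
      ⟨0, ⟨le_rfl, le_rfl⟩, rfl⟩ hk
    fin_cases k
    · exact Nat.one_pos
    · change 0 < i; omega
    · exact Nat.succ_pos i
  · intro k a ha b hb
    exact h.reflTransGen (hhi k) ha hb
  · intro a b hab
    refine hdisj _ _ _ _ (hhi a) (hhi b) ?_
    fin_cases a <;> fin_cases b
    · exact (hab rfl).elim
    · left; change i - 1 < i; omega
    · left; change i - 1 < i + 1; omega
    · right; change i - 1 < i; omega
    · exact (hab rfl).elim
    · left; change i < i + 1; omega
    · right; change i - 1 < i + 1; omega
    · right; change i < i + 1; omega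
    · exact (hab rfl).elim
  · intro k
    fin_cases k
    · exact ⟨f 1, ⟨1, ⟨le_rfl, show 1 ≤ i - 1 by omega⟩, rfl⟩, h.2 0 (by omega)⟩
    · exact ⟨f i, ⟨i, ⟨le_rfl, le_rfl⟩, rfl⟩, h1⟩
    · exact ⟨f j, ⟨j, ⟨hij, hjn⟩, rfl⟩, h2⟩
  · intro a b hab
    rcases lt_or_gt_of_ne hab with h' | h'
    · exact hadj a b h'
    · obtain ⟨s, hs, t, ht, hst⟩ := hadj b a h'
      exact ⟨t, ht, s, hs, hst.symm⟩

/-- A graph with an edge in which every vertex that is not isolated has degree at least three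
has a minor `K₄`. -/
theorem hasApexModel_of_three_neighbors [Finite V]
    (hdeg : ∀ z n, G.Adj z n → ∀ x y, ∃ n, G.Adj z n ∧ n ≠ x ∧ n ≠ y)
    {a b : V} (hab : G.Adj a b) : HasApexModel G := by
  classical
  have hP1 : ∃ f, IsPathSeq G 1 f := by
    refine ⟨fun k => if k = 0 then a else b, fun s hs t ht hst => ?_, fun i hi => ?_⟩
    · simp only [Set.mem_Iic] at hs ht
      dsimp only at hst
      split_ifs at hst with h1 h2 h2
      · omega
      · exact (hab.ne hst).elim
      · exact (hab.ne hst.symm).elim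
      · omega
    · obtain rfl : i = 0 := by omega
      simpa using hab
  -- A longest path: all neighbours of its first vertex lie on it.
  obtain ⟨n, hn1, hn, hmax⟩ : ∃ n, 1 ≤ n ∧ (∃ f, IsPathSeq G n f) ∧
      ∀ m f, IsPathSeq G m f → m ≤ n := by
    have hle : ∀ m, (∃ f, IsPathSeq G m f) → m ≤ Nat.card V := fun m ⟨f, hf⟩ => hf.length_lt.le
    refine ⟨Nat.findGreatest (fun m => ∃ f, IsPathSeq G m f) (Nat.card V),
      Nat.le_findGreatest (hle 1 hP1) hP1,
      Nat.findGreatest_spec (P := fun m => ∃ f, IsPathSeq G m f) (hle 1 hP1) hP1,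
      fun m f hf => Nat.le_findGreatest (hle m ⟨f, hf⟩) ⟨f, hf⟩⟩
  have hnb : ∀ f, IsPathSeq G n f → ∀ w, G.Adj (f 0) w → ∃ j, 1 ≤ j ∧ j ≤ n ∧ w = f j := by
    intro f hf w hw
    by_contra hcon
    push Not at hcon
    have : n + 1 ≤ n := hmax _ _ (hf.cons hw.symm fun j hj => by
      rcases Nat.eq_zero_or_pos j with rfl | hj0
      · exact hw.ne'
      · exact hcon j hj0 hj)
    omega
  have hnb2 : ∀ f, IsPathSeq G n f → ∀ w, ∃ j, 2 ≤ j ∧ j ≤ n ∧ G.Adj (f 0) (f j) ∧ f j ≠ w := by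
    intro f hf w
    obtain ⟨s, hs, hs1, hsw⟩ := hdeg (f 0) (f 1) (hf.2 0 (by omega)) (f 1) w
    obtain ⟨j, hj1, hjn, rfl⟩ := hnb f hf s hs
    refine ⟨j, ?_, hjn, hs, hsw⟩
    by_contra hlt
    exact hs1 (by rw [show j = 1 by omega])
  -- The shortest chord from the first vertex is taken over all longest paths, so that it can also
  -- be compared with chords of the rotated path.
  have hex : ∃ i, ∃ f, IsPathSeq G n f ∧ 2 ≤ i ∧ i ≤ n ∧ G.Adj (f 0) (f i) := by
    obtain ⟨f, hf⟩ := hn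
    obtain ⟨j, h2, hjn, h, -⟩ := hnb2 f hf (f 0)
    exact ⟨j, f, hf, h2, hjn, h⟩
  obtain ⟨f, hf, hi2, hin, hfi⟩ := Nat.find_spec hex
  have hmin : ∀ j g, IsPathSeq G n g → 2 ≤ j → j ≤ n → G.Adj (g 0) (g j) → Nat.find hex ≤ j :=
    fun j g hg h2 hjn h => Nat.find_min' hex ⟨g, hg, h2, hjn, h⟩
  generalize Nat.find hex = i at *
  obtain ⟨j, hj2, hjn, hj, hji⟩ := hnb2 f hf (f i)
  have hij : i < j := lt_of_le_of_ne (hmin j f hf hj2 hjn hj) fun h => hji (h ▸ rfl)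
  -- The rotated longest path starts at `f (i - 1)` and still has `f i` at index i. Minimality makes
  -- its chord avoiding `f i` end strictly beyond i.
  have hg := hf.rotate hin hfi
  obtain ⟨m, hm2, hmn, hm, hmi⟩ := hnb2 _ hg (f i)
  have him := hmin m _ hg hm2 hmn hm
  rw [if_neg (show ¬ m < i by omega)] at hm hmi
  rw [if_pos (show 0 < i by omega), Nat.sub_zero] at hm
  have him' : i < m := lt_of_le_of_ne him fun h => hmi (h ▸ rfl)
  exact hf.hasApexModel hi2 hij hjn him' hmn hfi hj hm

theorem exists_neighborSet_le_two [Finite V] (hG : ¬ HasApexModel G) {a b : V} (hab : G.Adj a b) :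
    ∃ z x y, G.Adj z x ∧ G.Adj z y ∧ ∀ n, G.Adj z n → n = x ∨ n = y := by
  by_contra hcon
  push Not at hcon
  refine hG (hasApexModel_of_three_neighbors (fun z n hzn x y => ?_) hab)
  by_contra hno
  push Not at hno
  have hno' : ∀ n, G.Adj z n → n = x ∨ n = y := fun n hn => by
    by_cases h : n = x
    · exact .inl h
    · exact .inr (hno n hn h)
  by_cases hx : G.Adj z x <;> by_cases hy : G.Adj z y
  · obtain ⟨n, h1, h2, h3⟩ := hcon z x y hx hy
    exact h3 (hno n h1 h2)
  · obtain ⟨n, h1, h2, -⟩ := hcon z x x hx hx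
    exact hy (hno n h1 h2 ▸ h1)
  · obtain ⟨n, h1, h2, -⟩ := hcon z y y hy hy
    exact hx (((hno' n h1).resolve_right h2) ▸ h1)
  · rcases hno' n hzn with rfl | rfl
    · exact hx hzn
    · exact hy hzn

end CompleteMinors

/-! ### From partitions into induced trees to forcing processes. -/

section Forcing

variable {V : Type*}

/-- For x ≠ y two edges disappear and at most one appears; for x = y no edge is added. -/
theorem ncard_edgeSet_suppress_lt [Finite V] {G : SimpleGraph V} {z x y : V} (hzx : G.Adj z x)
    (hzy : G.Adj z y) : (suppress G z x y).edgeSet.ncard < G.edgeSet.ncard := by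
  by_cases hxy : x = y
  · subst hxy
    refine Set.ncard_lt_ncard ?_ (Set.toFinite _)
    rw [SimpleGraph.edgeSet_ssubset_edgeSet]
    refine lt_of_le_of_ne (fun a b hab => ?_) fun h => ?_
    · rcases hab.2.2.2 with h | ⟨rfl, rfl⟩ | ⟨rfl, rfl⟩
      · exact h
      · exact (hab.1 rfl).elim
      · exact (hab.1 rfl).elim
    · rw [← h] at hzx
      exact hzx.2.1 rfl
  · have hsub : (suppress G z x y).edgeSet ⊆
        insert s(x, y) (G.edgeSet \ {s(z, x), s(z, y)}) := by
      intro e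
      induction e with
      | h a b =>
        intro hab
        rw [SimpleGraph.mem_edgeSet] at hab
        rcases hab.2.2.2 with h | ⟨rfl, rfl⟩ | ⟨rfl, rfl⟩
        · refine .inr ⟨h, ?_⟩
          have h2 := hab.2.1
          have h3 := hab.2.2.1
          simp only [Set.mem_insert_iff, Set.mem_singleton_iff, Sym2.eq_iff]
          tauto
        · exact .inl rfl
        · exact .inl Sym2.eq_swap
    have h1 := Set.ncard_le_ncard hsub (Set.toFinite _)
    have h2 := Set.ncard_insert_le s(x, y) (G.edgeSet \ {s(z, x), s(z, y)})
    have hsub2 : ({s(z, x), s(z, y)} : Set (Sym2 V)) ⊆ G.edgeSet := by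
      rintro e (rfl | rfl)
      · exact hzx
      · exact hzy
    have h3 := Set.ncard_sdiff hsub2 (Set.toFinite _)
    have h4 := Set.ncard_le_ncard hsub2 (Set.toFinite _)
    have h5 : ({s(z, x), s(z, y)} : Set (Sym2 V)).ncard = 2 := by
      rw [Set.ncard_pair]
      rw [Ne, Sym2.eq_iff]
      have := hzx.ne
      have := hzy.ne
      tauto
    omega

/-- Every partition of a graph without minor `K₄` into induced trees comes from a positive zero
forcing process. -/
theorem exists_isForcingList_of_classAcyclic.{u} {V ι : Type u} [Finite V] (G : SimpleGraph V)
    (hG : ¬ HasApexModel G) (c : V → ι) (hc : ClassConnected G c) (ha : ClassAcyclic G c) :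
    ∃ (Z : Set V) (l : List (V × V)), IsForcingList G Z l Set.univ ∧
      (∀ p ∈ l, c p.1 = c p.2) ∧ Set.InjOn c Z ∧ ∀ v, ∃ r ∈ Z, c r = c v := by
  induction hn : G.edgeSet.ncard using Nat.strong_induction_on generalizing G ι with
  | _ n ih =>
  subst hn
  by_cases hE : ∃ a b, G.Adj a b
  swap
  · push Not at hE
    refine ⟨Set.univ, [], .nil _, by simp, fun a _ b _ hab => ?_, fun v => ⟨v, trivial, rfl⟩⟩
    rcases (hc a b hab).cases_head with h | ⟨t, ht, -⟩
    · exact h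
    · exact (hE _ _ ht.1).elim
  obtain ⟨a, b, hab⟩ := hE
  obtain ⟨z, x, y, hzx, hzy, hN⟩ := exists_neighborSet_le_two hG hab
  by_cases hmono : ∃ n, G.Adj z n ∧ c z = c n
  · obtain ⟨x, y, hzx, hzy, hN, hcz⟩ : ∃ x y, G.Adj z x ∧ G.Adj z y ∧
        (∀ n, G.Adj z n → n = x ∨ n = y) ∧ c z = c x := by
      obtain ⟨n, hzn, hcn⟩ := hmono
      rcases hN n hzn with rfl | rfl
      · exact ⟨n, y, hzx, hzy, hN, hcn⟩
      · exact ⟨n, x, hzy, hzx, fun m hm => (hN m hm).symm, hcn⟩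
    -- Otherwise x, z, y would form a monochromatic triangle.
    have hxy : c x = c y → ¬ G.Adj x y := fun hcxy hadj => by
      refine ha x y hadj hcxy (.tail (.single (⟨⟨hzx.symm, hcz.symm⟩, ?_⟩ :
        MonoStep G c x z ∧ s(x, z) ≠ s(x, y))) ⟨⟨hzy, hcz.trans hcxy⟩, ?_⟩)
      · rw [Ne, Sym2.eq_iff]
        have := hzy.ne
        have := hzx.ne
        tauto
      · rw [Ne, Sym2.eq_iff]
        have := hzy.ne
        have := hzx.ne
        tauto
    -- The edge xy is added even if y has another colour, because white components may be connected
    -- through z.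
    obtain ⟨Z, l, hl, hcl, hinj, hsurj⟩ := ih _ (ncard_edgeSet_suppress_lt hzx hzy)
      (suppress G z x y) (fun h => hG (h.of_suppress hzx hzy)) (recolor c z)
      (hc.suppress fun s t hs ht _ _ => by
        rcases hN s hs with rfl | rfl <;> rcases hN t ht with rfl | rfl <;> tauto)
      (ha.suppress hzx hzy fun _ => .inr hcz) rfl
    have hz : z ∈ Z := by
      obtain ⟨r, hr, hrz⟩ := hsurj z
      exact eq_of_recolor_eq hrz ▸ hr
    obtain ⟨l', hl', hcl'⟩ := hl.exists_of_suppress hzx hzy hN hcz hxy rfl hz hcl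
    have hsurj' : ∀ v, v ≠ z → ∃ r ∈ Z \ {z}, c r = c v := by
      intro v hv
      obtain ⟨r, hr, hrv⟩ := hsurj v
      have hrz : r ≠ z := by
        rintro rfl
        exact hv (eq_of_recolor_eq hrv.symm)
      exact ⟨r, ⟨hr, hrz⟩, (recolor_eq_iff hrz hv).1 hrv⟩
    refine ⟨Z \ {z}, l', hl', hcl', fun s hs t ht hst => ?_, fun v => ?_⟩
    · exact hinj hs.1 ht.1 ((recolor_eq_iff hs.2 ht.2).2 hst)
    · by_cases hv : v = z
      · rw [hv, hcz]
        exact hsurj' x hzx.ne'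
      · exact hsurj' v hv
  · push Not at hmono
    have hsing : ∀ t, c t = c z → t = z := by
      intro t ht
      rcases (hc z t ht.symm).cases_head with h | ⟨s, hs, -⟩
      · exact h.symm
      · exact (hmono s hs.1 hs.2).elim
    -- With z alone in its class, suppression with x = y just isolates z, which is a root and stays
    -- black.
    obtain ⟨Z, l, hl, hcl, hinj, hsurj⟩ := ih _ (ncard_edgeSet_suppress_lt hzx hzx)
      (suppress G z x x) (fun h => hG (h.of_suppress hzx hzx)) (recolor c z)
      (hc.suppress fun s t hs _ hcs _ => (hmono s hs hcs.symm).elim)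
      (ha.suppress hzx hzx fun _ => .inl rfl) rfl
    have hz : z ∈ Z := by
      obtain ⟨r, hr, hrz⟩ := hsurj z
      exact eq_of_recolor_eq hrz ▸ hr
    refine ⟨Z, l, hl.of_suppress_of_mem hz (.inl rfl), fun p hp => ?_, fun s hs t ht hst => ?_,
      fun v => ?_⟩
    · have := hl.adj_of_mem p hp
      exact (recolor_eq_iff this.2.1 this.2.2.1).1 (hcl p hp)
    · by_cases hsz : s = z
      · subst hsz; exact (hsing t hst.symm).symm
      by_cases htz : t = z
      · subst htz; exact hsing s hst
      exact hinj hs ht ((recolor_eq_iff hsz htz).2 hst)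
    · by_cases hv : v = z
      · exact ⟨z, hz, by rw [hv]⟩
      obtain ⟨r, hr, hrv⟩ := hsurj v
      have hrz : r ≠ z := by
        rintro rfl
        exact hv (eq_of_recolor_eq hrv.symm)
      exact ⟨r, hr, (recolor_eq_iff hrz hv).1 hrv⟩

end Forcing

open Filter Topology

/-! ### Logarithms along polygonal arcs. -/

section Plane

/-- The plane as the complex numbers. -/
noncomputable def toComplex : Plane ≃L[ℝ] ℂ := Complex.equivRealProdCLM.symm

theorem toComplex_sub_ne_zero {a b : Plane} (h : a ≠ b) : toComplex a - toComplex b ≠ 0 :=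
  sub_ne_zero.2 fun he => h (toComplex.injective he)

theorem exists_eq_neg_smul_of_notMem_slitPlane {d u : Plane} (hu : u ≠ 0)
    (h : toComplex d / toComplex u ∉ Complex.slitPlane) : ∃ s : ℝ, 0 ≤ s ∧ d = -(s • u) := by
  rw [Complex.mem_slitPlane_iff, not_or, not_lt, not_not] at h
  have hu' : toComplex u ≠ 0 := fun h0 => hu (toComplex.injective (h0.trans (map_zero _).symm))
  refine ⟨-(toComplex d / toComplex u).re, by linarith [h.1], toComplex.injective ?_⟩
  have hre : toComplex d / toComplex u = ((toComplex d / toComplex u).re : ℂ) :=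
    Complex.ext rfl (by simpa using h.2)
  rw [div_eq_iff hu'] at hre
  rw [neg_smul, neg_neg, map_smul, Complex.real_smul]
  exact hre

/-- The quotient is a nonpositive real only when q lies between a and b, so the principal logarithm
is continuous off the segment. -/
theorem div_mem_slitPlane {a b q : Plane} (hq : q ∉ segment ℝ a b) :
    (toComplex b - toComplex q) / (toComplex a - toComplex q) ∈ Complex.slitPlane := by
  by_contra hcon
  have haq : a ≠ q := by rintro rfl; exact hq (left_mem_segment ℝ _ _)
  rw [← map_sub, ← map_sub] at hcon
  obtain ⟨s, hs, h⟩ := exists_eq_neg_smul_of_notMem_slitPlane (sub_ne_zero.2 haq) hcon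
  have hb : b = q - s • (a - q) := by rw [sub_eq_iff_eq_add] at h; rw [h]; abel
  refine hq ⟨s / (1 + s), 1 / (1 + s), by positivity, by positivity, by field_simp; ring, ?_⟩
  rw [hb]
  have : (1 + s) ≠ 0 := by positivity
  ext <;> simp <;> field_simp <;> ring

theorem continuousAt_log_div {a b q : Plane} (hq : q ∉ segment ℝ a b) :
    ContinuousAt (fun q => Complex.log
      ((toComplex b - toComplex q) / (toComplex a - toComplex q))) q := by
  have haq : a ≠ q := by rintro rfl; exact hq (left_mem_segment ℝ _ _)
  refine ContinuousAt.clog (ContinuousAt.div ?_ ?_ (toComplex_sub_ne_zero haq))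
    (div_mem_slitPlane hq)
  · exact continuousAt_const.sub toComplex.continuous.continuousAt
  · exact continuousAt_const.sub toComplex.continuous.continuousAt

theorem exp_log_div {a b q : Plane} (ha : a ≠ q) (hb : b ≠ q) :
    Complex.exp (Complex.log ((toComplex b - toComplex q) / (toComplex a - toComplex q))) =
      (toComplex b - toComplex q) / (toComplex a - toComplex q) :=
  Complex.exp_log (div_ne_zero (toComplex_sub_ne_zero hb) (toComplex_sub_ne_zero ha))

/-- The polygonal chain through `p 0, …, p n`. -/
def chainSet (p : ℕ → Plane) : ℕ → Set Plane
  | 0 => {p 0}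
  | n + 1 => chainSet p n ∪ segment ℝ (p n) (p (n + 1))

theorem mem_chainSet {p : ℕ → Plane} {n : ℕ} {z : Plane} :
    z ∈ chainSet p n ↔ z = p 0 ∨ ∃ i < n, z ∈ segment ℝ (p i) (p (i + 1)) := by
  induction n with
  | zero => simp [chainSet]
  | succ n ih =>
    rw [chainSet, Set.mem_union, ih]
    constructor
    · rintro ((h | ⟨i, hi, h⟩) | h)
      · exact .inl h
      · exact .inr ⟨i, by omega, h⟩
      · exact .inr ⟨n, by omega, h⟩
    · rintro (h | ⟨i, hi, h⟩)
      · exact .inl (.inl h)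
      · rcases Nat.lt_succ_iff_lt_or_eq.1 hi with hi | rfl
        · exact .inl (.inr ⟨i, hi, h⟩)
        · exact .inr h

theorem isCompact_segment (a b : Plane) : IsCompact (segment ℝ a b) := by
  rw [segment_eq_image_lineMap]
  exact isCompact_Icc.image (AffineMap.lineMap_continuous)

theorem isCompact_chainSet (p : ℕ → Plane) (n : ℕ) : IsCompact (chainSet p n) := by
  induction n with
  | zero => exact isCompact_singleton
  | succ n ih => exact ih.union (isCompact_segment _ _)

theorem last_mem_chainSet (p : ℕ → Plane) (n : ℕ) : p n ∈ chainSet p n := by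
  cases n with
  | zero => rfl
  | succ n => exact .inr (right_mem_segment ℝ _ _)

theorem isPreconnected_chainSet (p : ℕ → Plane) (n : ℕ) : IsPreconnected (chainSet p n) := by
  induction n with
  | zero => exact isPreconnected_singleton
  | succ n ih =>
    exact ih.union (p n) (last_mem_chainSet p n) (left_mem_segment ℝ _ _)
      (convex_segment _ _).isPreconnected

/-- Sum the principal logarithms of the segments; the quotients telescope. -/
theorem exists_log_chainSet (p : ℕ → Plane) (n : ℕ) : ∃ h : Plane → ℂ, ∀ q ∉ chainSet p n,
    ContinuousAt h q ∧ Complex.exp (h q) =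
      (toComplex (p n) - toComplex q) / (toComplex (p 0) - toComplex q) := by
  induction n with
  | zero =>
    refine ⟨fun _ => 0, fun q hq => ⟨continuousAt_const, ?_⟩⟩
    have : p 0 ≠ q := fun h => hq h.symm
    rw [Complex.exp_zero, div_self (toComplex_sub_ne_zero this)]
  | succ n ih =>
    obtain ⟨h, hh⟩ := ih
    refine ⟨fun q => h q + Complex.log ((toComplex (p (n + 1)) - toComplex q) /
      (toComplex (p n) - toComplex q)), fun q hq => ?_⟩
    rw [chainSet, Set.mem_union, not_or] at hq
    obtain ⟨h1, h2⟩ := hh q hq.1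
    have hn : p n ≠ q := by rintro rfl; exact hq.2 (left_mem_segment ℝ _ _)
    have hn' : p (n + 1) ≠ q := by rintro rfl; exact hq.2 (right_mem_segment ℝ _ _)
    refine ⟨h1.add (continuousAt_log_div hq.2), ?_⟩
    rw [Complex.exp_add, h2, exp_log_div hn hn']
    have := toComplex_sub_ne_zero hn
    field_simp

/-- The arc `A` from `x` to `y` consists of the segment from `x` to `m` and of a connected
compact set `R` that does not contain `x`, outside of which `h` is a continuous logarithm of
`(y - q) / (m - q)`. -/
structure IsArcGerm (A : Set Plane) (x y m : Plane) (R : Set Plane) (h : Plane → ℂ) : Prop where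
  ne : m ≠ x
  eq_union : A = segment ℝ x m ∪ R
  isCompact : IsCompact R
  notMem : x ∉ R
  mid_mem : m ∈ R
  end_mem : y ∈ R
  isPreconnected : IsPreconnected R
  log : ∀ q ∉ R, ContinuousAt h q ∧ Complex.exp (h q) =
    (toComplex y - toComplex q) / (toComplex m - toComplex q)

/-- The first segment is split off because its direction determines the behaviour near x, while the
rest stays away from x. -/
theorem IsPolygonalArc.exists_isArcGerm {A : Set Plane} {x y : Plane} (hA : IsPolygonalArc A x y) :
    ∃ m R h, IsArcGerm A x y m R h := by
  obtain ⟨n, p, hn, rfl, rfl, hne, hdisj, rfl⟩ := hA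
  obtain ⟨n, rfl⟩ : ∃ k, n = k + 1 := ⟨n - 1, by omega⟩
  obtain ⟨h, hh⟩ := exists_log_chainSet (fun i => p (i + 1)) n
  refine ⟨p 1, chainSet (fun i => p (i + 1)) n, h, (hne 0 hn).symm, ?_, isCompact_chainSet _ _,
    ?_, mem_chainSet.2 (.inl rfl), last_mem_chainSet _ _, isPreconnected_chainSet _ _, hh⟩
  · ext z
    rw [Set.mem_union, mem_chainSet]
    simp only [Set.mem_iUnion, Set.mem_Iio, exists_prop]
    constructor
    · rintro ⟨i, hi, hz⟩
      rcases i with _ | i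
      · exact .inl hz
      · exact .inr (.inr ⟨i, by omega, hz⟩)
    · rintro (hz | rfl | ⟨i, hi, hz⟩)
      · exact ⟨0, hn, hz⟩
      · exact ⟨0, hn, right_mem_segment ℝ _ _⟩
      · exact ⟨i + 1, by omega, hz⟩
  · rw [mem_chainSet]
    rintro (h0 | ⟨i, hi, h0⟩)
    · exact hne 0 hn h0
    · obtain ⟨h1, h2⟩ := hdisj 0 (i + 1) (by omega) (by omega) (p 0) (left_mem_segment ℝ _ _) h0
      obtain rfl : i = 0 := by omega
      exact hne 0 hn h2

variable {A R : Set Plane} {x y m : Plane} {h : Plane → ℂ}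

theorem IsArcGerm.isCompact_arc (hg : IsArcGerm A x y m R h) : IsCompact A := by
  rw [hg.eq_union]
  exact (isCompact_segment _ _).union hg.isCompact

theorem IsArcGerm.start_mem (hg : IsArcGerm A x y m R h) : x ∈ A := by
  rw [hg.eq_union]
  exact .inl (left_mem_segment ℝ _ _)

theorem IsArcGerm.subset (hg : IsArcGerm A x y m R h) : R ⊆ A := by
  rw [hg.eq_union]
  exact Set.subset_union_right

theorem IsArcGerm.add_smul_mem (hg : IsArcGerm A x y m R h) {t : ℝ} (h0 : 0 ≤ t) (h1 : t ≤ 1) :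
    x + t • (m - x) ∈ A := by
  rw [hg.eq_union]
  refine .inl ?_
  rw [segment_eq_image']
  exact ⟨t, ⟨h0, h1⟩, rfl⟩

/-- The logarithm of `(y - q) / (x - q)` outside the arc from `x` to `y`. -/
theorem IsArcGerm.log_arc (hg : IsArcGerm A x y m R h) {q : Plane} (hq : q ∉ A) :
    ContinuousAt (fun q => Complex.log ((toComplex m - toComplex q) /
      (toComplex x - toComplex q)) + h q) q ∧
    Complex.exp (Complex.log ((toComplex m - toComplex q) /
      (toComplex x - toComplex q)) + h q) =
      (toComplex y - toComplex q) / (toComplex x - toComplex q) := by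
  have hx : x ≠ q := by rintro rfl; exact hq hg.start_mem
  have hm : m ≠ q := by rintro rfl; exact hq (hg.subset hg.mid_mem)
  have hqR : q ∉ R := fun h => hq (hg.subset h)
  have hqs : q ∉ segment ℝ x m := fun h => hq (hg.eq_union ▸ .inl h)
  obtain ⟨h1, h2⟩ := hg.log q hqR
  refine ⟨(continuousAt_log_div hqs).add h1, ?_⟩
  rw [Complex.exp_add, h2, exp_log_div hx hm]
  have := toComplex_sub_ne_zero hm
  field_simp

/-- Multiplying the quotient by t > 0 leaves its argument unchanged and removes the pole at v. -/
theorem tendsto_log_im {v d u : Plane} (hu : u ≠ 0)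
    (hs : toComplex d / toComplex (-u) ∈ Complex.slitPlane) :
    Tendsto (fun t : ℝ => (Complex.log ((toComplex (v + d) - toComplex (v + t • u)) /
      (toComplex v - toComplex (v + t • u)))).im) (𝓝[>] 0)
      (𝓝 (Complex.arg (toComplex d / toComplex (-u)))) := by
  have hu' : toComplex u ≠ 0 := fun h0 => hu (toComplex.injective (h0.trans (map_zero _).symm))
  have hc : ContinuousAt (fun t : ℝ => Complex.arg
      ((toComplex d - t * toComplex u) / toComplex (-u))) 0 := by
    refine ContinuousAt.comp (f := fun t : ℝ => (toComplex d - t * toComplex u) / toComplex (-u))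
      (g := Complex.arg) (Complex.continuousAt_arg (by simpa using hs)) ?_
    fun_prop
  have hc' := hc.tendsto.mono_left (nhdsWithin_le_nhds (s := Set.Ioi 0))
  simp only [Complex.ofReal_zero, zero_mul, sub_zero] at hc'
  refine hc'.congr' ?_
  filter_upwards [self_mem_nhdsWithin] with t ht
  have ht : 0 < t := ht
  rw [Complex.log_im, ← Complex.arg_real_mul ((toComplex (v + d) - toComplex (v + t • u)) / (toComplex v - toComplex (v + t • u))) ht]
  congr 1
  have : (t : ℂ) ≠ 0 := by exact_mod_cast ht.ne'
  simp only [map_add, map_neg, map_smul, Complex.real_smul]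
  rw [show toComplex v - (toComplex v + t * toComplex u) = -(t * toComplex u) by ring]
  field_simp
  ring

/-- The sign contributes π, and the order of the arguments decides which of ±π stays in the
principal range. This choice produces the jump of the winding number. -/
theorem arg_neg_div_of_lt {a b : ℂ} (ha : a ≠ 0) (hb : b ≠ 0) (h : a.arg < b.arg) :
    (-(a / b)).arg = a.arg - b.arg + Real.pi := by
  have key : -(a / b) = ((‖a‖ / ‖b‖ : ℝ) : ℂ) * (Complex.cos ((a.arg - b.arg + Real.pi : ℝ) : ℂ) +
      Complex.sin ((a.arg - b.arg + Real.pi : ℝ) : ℂ) * Complex.I) := by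
    rw [← Complex.exp_mul_I]
    push_cast
    rw [add_mul, sub_mul, Complex.exp_add, Complex.exp_sub, Complex.exp_pi_mul_I]
    conv_lhs => rw [← Complex.norm_mul_exp_arg_mul_I a, ← Complex.norm_mul_exp_arg_mul_I b]
    have : (‖b‖ : ℂ) ≠ 0 := by simpa using hb
    field_simp
  rw [key, Complex.arg_mul_cos_add_sin_mul_I (by positivity)]
  have h1 := Complex.neg_pi_lt_arg a
  have h2 := Complex.arg_le_pi b
  constructor <;> linarith

theorem arg_neg_div_of_gt {a b : ℂ} (ha : a ≠ 0) (hb : b ≠ 0) (h : b.arg < a.arg) :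
    (-(a / b)).arg = a.arg - b.arg - Real.pi := by
  have key : -(a / b) = ((‖a‖ / ‖b‖ : ℝ) : ℂ) * (Complex.cos ((a.arg - b.arg - Real.pi : ℝ) : ℂ) +
      Complex.sin ((a.arg - b.arg - Real.pi : ℝ) : ℂ) * Complex.I) := by
    rw [← Complex.exp_mul_I]
    push_cast
    rw [sub_mul, sub_mul, Complex.exp_sub, Complex.exp_sub, Complex.exp_pi_mul_I]
    conv_lhs => rw [← Complex.norm_mul_exp_arg_mul_I a, ← Complex.norm_mul_exp_arg_mul_I b]
    have : (‖b‖ : ℂ) ≠ 0 := by simpa using hb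
    field_simp
  rw [key, Complex.arg_mul_cos_add_sin_mul_I (by positivity)]
  have h1 := Complex.neg_pi_lt_arg b
  have h2 := Complex.arg_le_pi a
  constructor <;> linarith

/-- The values of `w` lie in 2πiℤ, so continuity makes them constant. -/
theorem im_eq_of_isPreconnected {X : Set Plane} (hX : IsPreconnected X) {w : Plane → ℂ}
    (hw : ∀ q ∈ X, ContinuousAt w q ∧ Complex.exp (w q) = 1) {a b : Plane} (ha : a ∈ X)
    (hb : b ∈ X) : (w a).im = (w b).im := by
  have hpi := Real.two_pi_pos
  have hint : ∀ q ∈ X, ∃ n : ℤ, (w q).im / (2 * Real.pi) = n := by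
    intro q hq
    obtain ⟨n, hn⟩ := Complex.exp_eq_one_iff.1 (hw q hq).2
    refine ⟨n, ?_⟩
    rw [hn]
    simp
  have hcont : ContinuousOn (fun q => (w q).im / (2 * Real.pi)) X := fun q hq =>
    ((Complex.continuous_im.continuousAt.comp (hw q hq).1).div_const _).continuousWithinAt
  have key : ∀ a ∈ X, ∀ b ∈ X, ¬ (w a).im / (2 * Real.pi) < (w b).im / (2 * Real.pi) := by
    intro a ha b hb hlt
    obtain ⟨n, hn⟩ := hint a ha
    obtain ⟨k, hk⟩ := hint b hb
    rw [hn, hk, Int.cast_lt] at hlt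
    have hlt' : (n : ℝ) + 1 ≤ k := by exact_mod_cast hlt
    have := hX.intermediate_value ha hb hcont
    rw [hn, hk] at this
    obtain ⟨q, hq, hqe⟩ := this (show (n : ℝ) + 1 / 2 ∈ Set.Icc (n : ℝ) k by
      constructor <;> linarith)
    obtain ⟨j, hj⟩ := hint q hq
    dsimp only at hqe
    rw [hj] at hqe
    have h1 : n < j := by
      have : (n : ℝ) < j := by linarith
      exact_mod_cast this
    have h2 : j < n + 1 := by
      have : (j : ℝ) < n + 1 := by linarith
      exact_mod_cast this
    omega
  have := le_antisymm (not_lt.1 (key b hb a ha)) (not_lt.1 (key a ha b hb))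
  field_simp at this
  exact this

end Plane

/-! ### Three arcs leaving a common point. -/

section Germs

variable {v : Plane} {y m : Fin 3 → Plane} {A R : Fin 3 → Set Plane} {h : Fin 3 → Plane → ℂ}

/-- Two arcs that meet only in their common starting point leave it in different directions. -/
theorem germ_div_mem_slitPlane (hg : ∀ i, IsArcGerm (A i) v (y i) (m i) (R i) (h i))
    (hA : ∀ i j, i ≠ j → ∀ z ∈ A i, z ∈ A j → z = v) {i j : Fin 3} (hij : i ≠ j) :
    toComplex (m i - v) / toComplex (-(m j - v)) ∈ Complex.slitPlane := by
  by_contra hcon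
  have hi : m i - v ≠ 0 := sub_ne_zero.2 (hg i).ne
  have hj : m j - v ≠ 0 := sub_ne_zero.2 (hg j).ne
  obtain ⟨s, hs, he⟩ := exists_eq_neg_smul_of_notMem_slitPlane (neg_ne_zero.2 hj) hcon
  rw [smul_neg, neg_neg] at he
  have hs0 : 0 < s := lt_of_le_of_ne hs (by rintro rfl; exact hi (by rw [he, zero_smul]))
  rcases le_total s 1 with h1 | h1
  · have hmem := (hg j).add_smul_mem hs h1
    rw [← he, add_sub_cancel] at hmem
    exact (hg i).ne (hA i j hij _ ((hg i).subset (hg i).mid_mem) hmem)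
  · have hmem := (hg i).add_smul_mem (t := s⁻¹) (by positivity) (inv_le_one_of_one_le₀ h1)
    rw [he, smul_smul, inv_mul_cancel₀ hs0.ne', one_smul, add_sub_cancel] at hmem
    exact (hg j).ne (hA i j hij _ hmem ((hg j).subset (hg j).mid_mem))

/-- A point off the arc and closer to x than m cannot lie in the direction of the first segment. -/
theorem IsArcGerm.not_add_smul_mem {A R : Set Plane} {x y m q : Plane} {h : Plane → ℂ}
    (hg : IsArcGerm A x y m R h) (hq : q ∉ A) (hlt : ‖q - x‖ < ‖m - x‖) {s t : ℝ} (ht : 0 < t)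
    (hs : 0 ≤ s) : t • (q - x) ≠ s • (m - x) := by
  intro he
  have hq' : q - x = (s / t) • (m - x) := by
    rw [div_eq_inv_mul, mul_smul, ← he, smul_smul, inv_mul_cancel₀ ht.ne', one_smul]
  have hst : 0 ≤ s / t := by positivity
  have hn : 0 < ‖m - x‖ := norm_pos_iff.2 (sub_ne_zero.2 hg.ne)
  have hst1 : s / t < 1 := by
    rw [hq', norm_smul, Real.norm_of_nonneg hst] at hlt
    by_contra hge
    nlinarith [not_lt.1 hge]
  have hmem := hg.add_smul_mem hst hst1.le
  rw [← hq', add_sub_cancel] at hmem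
  exact hq hmem

theorem IsArcGerm.div_mem_slitPlane {A R : Set Plane} {x y m q : Plane} {h : Plane → ℂ}
    (hg : IsArcGerm A x y m R h) (hq : q ∉ A) (hlt : ‖q - x‖ < ‖m - x‖) :
    toComplex (m - x) / toComplex (-(q - x)) ∈ Complex.slitPlane := by
  by_contra hcon
  have hqx : q - x ≠ 0 := sub_ne_zero.2 (by rintro rfl; exact hq hg.start_mem)
  obtain ⟨s, hs, he⟩ := exists_eq_neg_smul_of_notMem_slitPlane (neg_ne_zero.2 hqx) hcon
  rw [smul_neg, neg_neg] at he
  have hs0 : 0 < s := lt_of_le_of_ne hs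
    (by rintro rfl; exact sub_ne_zero.2 hg.ne (by rw [he, zero_smul]))
  exact hg.not_add_smul_mem hq hlt hs0 zero_le_one (by rw [he, one_smul])

theorem isPreconnected_ray (v u : Plane) :
    IsPreconnected ((fun t : ℝ => v + t • u) '' Set.Ioc 0 1) :=
  (convex_Ioc 0 1).isPreconnected.image _ (by fun_prop)

/-- The closed curve formed by `A i`, `A k` and a curve in `E` separates the two sides at `v`. -/
theorem false_of_arg_lt (hg : ∀ i, IsArcGerm (A i) v (y i) (m i) (R i) (h i))
    (hA : ∀ i j, i ≠ j → ∀ z ∈ A i, z ∈ A j → z = v) {i j k : Fin 3} (hij : i ≠ j) (hkj : k ≠ j)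
    {E : Set Plane} (hvE : v ∉ E) {f : Plane → ℂ}
    (hf : ∀ q ∉ E, ContinuousAt f q ∧ Complex.exp (f q) =
      (toComplex (y k) - toComplex q) / (toComplex (y i) - toComplex q))
    (hyE : y i ∈ E ∧ y k ∈ E) (hAE : ∀ z ∈ A j, z ∉ E) {O : Set Plane} (hO : IsPreconnected O)
    (hOA : ∀ i, ∀ z ∈ O, z ∉ A i) (hOE : ∀ z ∈ O, z ∉ E) (hy : y j ∈ closure O) {q₀ : Plane}
    (hq₀ : q₀ ∈ O) (hseg : ∀ t : ℝ, 0 < t → t ≤ 1 → (∀ l, v + t • (q₀ - v) ∉ R l) ∧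
      v + t • (q₀ - v) ∉ E) (hnear : ∀ l, ‖q₀ - v‖ < ‖m l - v‖)
    (h1 : (toComplex (m i - v) / toComplex (-(q₀ - v))).arg <
      (toComplex (m j - v) / toComplex (-(q₀ - v))).arg)
    (h2 : (toComplex (m j - v) / toComplex (-(q₀ - v))).arg <
      (toComplex (m k - v) / toComplex (-(q₀ - v))).arg) : False := by
  -- 2πi times the winding number about q of the closed curve from v along `A i`, through `E`, and
  -- back along `A k`.
  set w : Plane → ℂ := fun q =>
    (Complex.log ((toComplex (m i) - toComplex q) / (toComplex v - toComplex q)) + h i q) + f q -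
    (Complex.log ((toComplex (m k) - toComplex q) / (toComplex v - toComplex q)) + h k q) with hw
  have hwexp : ∀ q, q ∉ A i → q ∉ A k → q ∉ E → ContinuousAt w q ∧ Complex.exp (w q) = 1 := by
    intro q hqi hqk hqE
    obtain ⟨a1, a2⟩ := (hg i).log_arc hqi
    obtain ⟨b1, b2⟩ := (hg k).log_arc hqk
    obtain ⟨c1, c2⟩ := hf q hqE
    refine ⟨(a1.add c1).sub b1, ?_⟩
    simp only [hw]
    rw [Complex.exp_sub, Complex.exp_add, a2, b2, c2]
    have n1 : toComplex v - toComplex q ≠ 0 :=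
      toComplex_sub_ne_zero (by rintro rfl; exact hqi (hg i).start_mem)
    have n2 : toComplex (y i) - toComplex q ≠ 0 :=
      toComplex_sub_ne_zero (by rintro rfl; exact hqE hyE.1)
    have n3 : toComplex (y k) - toComplex q ≠ 0 :=
      toComplex_sub_ne_zero (by rintro rfl; exact hqE hyE.2)
    field_simp
  have hdj : m j - v ≠ 0 := sub_ne_zero.2 (hg j).ne
  have hq₀v : q₀ - v ≠ 0 :=
    sub_ne_zero.2 (by rintro rfl; exact hOA j _ hq₀ (hg j).start_mem)
  -- A connected set off the closed curve that approaches v along `A j` and along the ray from q₀.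
  set X : Set Plane := ((insert (y j) O ∪ R j) ∪ ((fun t : ℝ => v + t • (m j - v)) '' Set.Ioc 0 1)) ∪
    ((fun t : ℝ => v + t • (q₀ - v)) '' Set.Ioc 0 1) with hX
  have hXpre : IsPreconnected X := by
    refine IsPreconnected.union q₀ (.inl (.inl (.inr hq₀))) ⟨1, by simp, by simp⟩ ?_
      (isPreconnected_ray _ _)
    refine IsPreconnected.union (m j) (.inr (hg j).mid_mem) ⟨1, by simp, by simp⟩ ?_
      (isPreconnected_ray _ _)
    refine IsPreconnected.union (y j) (.inl rfl) (hg j).end_mem ?_ (hg j).isPreconnected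
    exact hO.subset_closure (Set.subset_insert _ _) (Set.insert_subset hy subset_closure)
  have hXw : ∀ q ∈ X, ContinuousAt w q ∧ Complex.exp (w q) = 1 := by
    have hj : ∀ q ∈ A j, q ≠ v → ContinuousAt w q ∧ Complex.exp (w q) = 1 := by
      intro q hq hqv
      exact hwexp q (fun h => hqv (hA i j hij q h hq)) (fun h => hqv (hA k j hkj q h hq)) (hAE q hq)
    rintro q ((((rfl | hq) | hq) | ⟨t, ⟨ht0, ht1⟩, rfl⟩) | ⟨t, ⟨ht0, ht1⟩, rfl⟩)
    · exact hj _ ((hg j).subset (hg j).end_mem) fun h => (hg j).notMem (h ▸ (hg j).end_mem)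
    · exact hwexp q (hOA i q hq) (hOA k q hq) (hOE q hq)
    · exact hj q ((hg j).subset hq) (by rintro rfl; exact (hg j).notMem hq)
    · refine hj _ ((hg j).add_smul_mem ht0.le ht1) fun h => ?_
      have := smul_eq_zero.1 (add_eq_left.1 h)
      exact this.elim ht0.ne' hdj
    · have hnot : ∀ l, v + t • (q₀ - v) ∉ A l := by
        intro l hl
        rw [(hg l).eq_union] at hl
        rcases hl with hl | hl
        · rw [segment_eq_image'] at hl
          obtain ⟨s, ⟨hs0, -⟩, hs⟩ := hl
          exact (hg l).not_add_smul_mem (hOA l _ hq₀) (hnear l) ht0 hs0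
            (add_left_cancel hs).symm
        · exact (hseg t ht0 ht1).1 l hl
      exact hwexp _ (hnot i) (hnot k) (hseg t ht0 ht1).2
  have hq₀X : q₀ ∈ X := .inl (.inl (.inl (.inr hq₀)))
  have hlim : ∀ u : Plane, u ≠ 0 → (∀ t : ℝ, 0 < t → t ≤ 1 → v + t • u ∈ X) →
      toComplex (m i - v) / toComplex (-u) ∈ Complex.slitPlane →
      toComplex (m k - v) / toComplex (-u) ∈ Complex.slitPlane →
      (w q₀).im = (toComplex (m i - v) / toComplex (-u)).arg + (h i v).im + (f v).im -
        ((toComplex (m k - v) / toComplex (-u)).arg + (h k v).im) := by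
    intro u hu hmem hsi hsk
    have t1 := tendsto_log_im (v := v) hu hsi
    have t2 := tendsto_log_im (v := v) hu hsk
    rw [add_sub_cancel] at t1 t2
    have hray : Tendsto (fun t : ℝ => v + t • u) (𝓝[>] 0) (𝓝 v) := by
      have : ContinuousAt (fun t : ℝ => v + t • u) 0 := by fun_prop
      have := this.tendsto.mono_left (nhdsWithin_le_nhds (s := Set.Ioi 0))
      simpa using this
    have hc : ∀ g : Plane → ℂ, ContinuousAt g v →
        Tendsto (fun t : ℝ => (g (v + t • u)).im) (𝓝[>] 0) (𝓝 (g v).im) := fun g hgc =>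
      (Complex.continuous_im.tendsto _).comp (hgc.tendsto.comp hray)
    have t3 := hc _ ((hg i).log v (hg i).notMem).1
    have t4 := hc _ ((hg k).log v (hg k).notMem).1
    have t5 := hc _ (hf v hvE).1
    have t6 := ((t1.add t3).add t5).sub (t2.add t4)
    refine tendsto_nhds_unique ?_ t6
    refine (tendsto_const_nhds (x := (w q₀).im)).congr' ?_
    filter_upwards [Ioc_mem_nhdsGT (zero_lt_one' ℝ)] with t ht
    rw [im_eq_of_isPreconnected hXpre hXw hq₀X (hmem t ht.1 ht.2)]
    simp only [hw, Complex.sub_im, Complex.add_im]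
  have e1 := hlim (q₀ - v) hq₀v (fun t h0 h1 => .inr ⟨t, ⟨h0, h1⟩, rfl⟩)
    ((hg i).div_mem_slitPlane (hOA i _ hq₀) (hnear i))
    ((hg k).div_mem_slitPlane (hOA k _ hq₀) (hnear k))
  have e2 := hlim (m j - v) hdj (fun t h0 h1 => .inl (.inr ⟨t, ⟨h0, h1⟩, rfl⟩))
    (germ_div_mem_slitPlane hg hA hij) (germ_div_mem_slitPlane hg hA hkj)
  have hz : ∀ u : Plane, u ≠ 0 → toComplex u ≠ 0 := fun u hu h0 =>
    hu (toComplex.injective (h0.trans (map_zero _).symm))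
  have hne : ∀ l, toComplex (m l - v) / toComplex (-(q₀ - v)) ≠ 0 := fun l =>
    div_ne_zero (hz _ (sub_ne_zero.2 (hg l).ne)) (hz _ (neg_ne_zero.2 hq₀v))
  have hdiv : ∀ l, toComplex (m l - v) / toComplex (-(m j - v)) =
      -((toComplex (m l - v) / toComplex (-(q₀ - v))) /
        (toComplex (m j - v) / toComplex (-(q₀ - v)))) := by
    intro l
    have n1 := hz _ (neg_ne_zero.2 hq₀v)
    have n2 := hz _ hdj
    rw [map_neg toComplex (m j - v)]
    field_simp
  -- The limit along `A j` exceeds the limit along the ray from q₀ by 2π, although both equal `(w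
  -- q₀).im`.
  rw [hdiv i, hdiv k, arg_neg_div_of_lt (hne i) (hne j) h1,
    arg_neg_div_of_gt (hne k) (hne j) h2] at e2
  have := Real.pi_pos
  linarith

/-- Three arcs from `v` whose ends are pairwise joined outside of the third arc: their ends and
`v` are not all in the closure of one face. -/
theorem false_of_germs (hg : ∀ i, IsArcGerm (A i) v (y i) (m i) (R i) (h i))
    (hA : ∀ i j, i ≠ j → ∀ z ∈ A i, z ∈ A j → z = v) {E : Fin 3 → Set Plane}
    (hEc : ∀ j, IsClosed (E j)) (hvE : ∀ j, v ∉ E j)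
    (hE : ∀ i j k, i ≠ j → j ≠ k → i ≠ k → y i ∈ E j ∧ ∃ f : Plane → ℂ, ∀ q ∉ E j,
      ContinuousAt f q ∧ Complex.exp (f q) =
        (toComplex (y k) - toComplex q) / (toComplex (y i) - toComplex q))
    (hAE : ∀ j, ∀ z ∈ A j, z ∉ E j) {O : Set Plane} (hO : IsPreconnected O)
    (hOA : ∀ i, ∀ z ∈ O, z ∉ A i) (hOE : ∀ j, ∀ z ∈ O, z ∉ E j) (hv : v ∈ closure O)
    (hy : ∀ j, y j ∈ closure O) : False := by
  have hF : ∀ᶠ q in 𝓝 v, ∀ l, q ∉ R l ∧ q ∉ E l ∧ ‖q - v‖ < ‖m l - v‖ := by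
    rw [eventually_all]
    intro l
    refine ((hg l).isCompact.isClosed.isOpen_compl.eventually_mem (hg l).notMem).and
      (((hEc l).isOpen_compl.eventually_mem (hvE l)).and ?_)
    have : ContinuousAt (fun q : Plane => ‖q - v‖) v := by fun_prop
    refine this.eventually_lt continuousAt_const ?_
    simpa using norm_pos_iff.2 (sub_ne_zero.2 (hg l).ne)
  obtain ⟨δ, hδ, hball⟩ := Metric.eventually_nhds_iff_ball.1 hF
  obtain ⟨q₀, hq₀, hd⟩ := Metric.mem_closure_iff.1 hv δ hδ
  rw [dist_comm] at hd
  have hray : ∀ t : ℝ, 0 < t → t ≤ 1 → v + t • (q₀ - v) ∈ Metric.ball v δ := by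
    intro t h0 h1
    rw [mem_ball_iff_norm, add_sub_cancel_left, norm_smul, Real.norm_of_nonneg h0.le]
    rw [dist_eq_norm] at hd
    nlinarith [norm_nonneg (q₀ - v)]
  have hnear : ∀ l, ‖q₀ - v‖ < ‖m l - v‖ := fun l => (hball q₀ hd l).2.2
  -- Angles are measured from the direction opposite to q₀, so the branch cut points towards q₀.
  set θ : Fin 3 → ℝ := fun l => (toComplex (m l - v) / toComplex (-(q₀ - v))).arg with hθ
  have hq₀v : -(q₀ - v) ≠ 0 :=
    neg_ne_zero.2 (sub_ne_zero.2 (by rintro rfl; exact hOA 0 _ hq₀ (hg 0).start_mem))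
  have hz : ∀ u : Plane, u ≠ 0 → toComplex u ≠ 0 := fun u hu h0 =>
    hu (toComplex.injective (h0.trans (map_zero _).symm))
  have hinj : Function.Injective θ := by
    intro a b hab
    by_contra hne
    have hs := germ_div_mem_slitPlane hg hA hne
    have n1 := hz _ hq₀v
    have n2 := hz _ (sub_ne_zero.2 (hg a).ne)
    have n3 := hz _ (sub_ne_zero.2 (hg b).ne)
    have he := (Complex.arg_eq_arg_iff (div_ne_zero n3 n1) (div_ne_zero n2 n1)).1 hab.symm
    rw [map_neg toComplex (m b - v)] at hs
    have : toComplex (m a - v) / -toComplex (m b - v) =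
        ((-(‖toComplex (m a - v) / toComplex (-(q₀ - v))‖ /
          ‖toComplex (m b - v) / toComplex (-(q₀ - v))‖) : ℝ) : ℂ) := by
      push_cast
      rw [← mul_div_assoc, div_left_inj' n1] at he
      rw [div_neg, ← (div_eq_iff n3).2 he.symm]
    rw [this, Complex.ofReal_mem_slitPlane] at hs
    have : 0 ≤ ‖toComplex (m a - v) / toComplex (-(q₀ - v))‖ /
          ‖toComplex (m b - v) / toComplex (-(q₀ - v))‖ := by positivity
    linarith
  -- Sorting the angles makes `σ 1` the middle arc; the other two form the closed curve.
  have hmono : StrictMono (θ ∘ Tuple.sort θ) :=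
    (Tuple.monotone_sort θ).strictMono_of_injective (hinj.comp (Tuple.sort θ).injective)
  set σ := Tuple.sort θ
  have h01 : σ 0 ≠ σ 1 := σ.injective.ne (by decide)
  have h12 : σ 1 ≠ σ 2 := σ.injective.ne (by decide)
  have h02 : σ 0 ≠ σ 2 := σ.injective.ne (by decide)
  obtain ⟨hy0, f, hf⟩ := hE (σ 0) (σ 1) (σ 2) h01 h12 h02
  obtain ⟨hy2, -⟩ := hE (σ 2) (σ 1) (σ 0) h12.symm h01.symm h02.symm
  exact false_of_arg_lt hg hA h01 h12.symm (hvE (σ 1)) hf ⟨hy0, hy2⟩ (hAE _) hO hOA (hOE _) (hy _)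
    hq₀ (fun t h0 h1 => ⟨fun l => (hball _ (hray t h0 h1) l).1, (hball _ (hray t h0 h1) _).2.1⟩)
    hnear (hmono (by decide : (0 : Fin 3) < 1)) (hmono (by decide : (1 : Fin 3) < 2))

end Germs

/-! ### The outer face, and why outerplanar graphs have no such minor. -/

section Drawings

variable {V : Type*} {G : SimpleGraph V}

/-- The region is the image of the punctured plane under a radial push by r. -/
theorem isPreconnected_norm_gt {r : ℝ} (hr : 0 ≤ r) : IsPreconnected {q : Plane | r < ‖q‖} := by
  have hrank : 1 < Module.rank ℝ Plane := by
    rw [rank_prod', Module.rank_self]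
    norm_num
  have himg : {q : Plane | r < ‖q‖} = (fun q : Plane => (1 + r / ‖q‖) • q) '' {0}ᶜ := by
    ext q
    constructor
    · intro hq
      have hq : r < ‖q‖ := hq
      have hq0 : 0 < ‖q‖ := hr.trans_lt hq
      have hs : 0 < ‖q‖ - r := by linarith
      refine ⟨((‖q‖ - r) / ‖q‖) • q, ?_, ?_⟩
      · exact smul_ne_zero (by positivity) (norm_pos_iff.1 hq0)
      · dsimp only
        rw [norm_smul, Real.norm_of_nonneg (by positivity), smul_smul]
        convert one_smul ℝ q using 2
        field_simp
        ring
    · rintro ⟨q, hq, rfl⟩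
      have hq0 : 0 < ‖q‖ := norm_pos_iff.2 hq
      show r < ‖(1 + r / ‖q‖) • q‖
      rw [norm_smul, Real.norm_of_nonneg (by positivity), add_mul, one_mul,
        div_mul_cancel₀ _ hq0.ne']
      linarith
  rw [himg]
  refine (isConnected_compl_singleton_of_one_lt_rank hrank 0).isPreconnected.image _ ?_
  refine ContinuousOn.smul (continuousOn_const.add (continuousOn_const.div
    continuous_norm.continuousOn fun q hq => ?_)) continuousOn_id
  exact norm_ne_zero_iff.2 hq

theorem PlaneDrawing.isCompact_arc (D : PlaneDrawing G) {e : Sym2 V} (he : e ∈ G.edgeSet) :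
    IsCompact (D.arc e) := by
  induction e with
  | h a b =>
    obtain ⟨m, R, h, hg⟩ := (D.isArc a b he).exists_isArcGerm
    exact hg.isCompact_arc

theorem PlaneDrawing.isCompact_carrier [Finite V] (D : PlaneDrawing G) : IsCompact D.carrier :=
  (Set.finite_range _).isCompact.union
    ((Set.toFinite G.edgeSet).isCompact_biUnion fun _ he => D.isCompact_arc he)

/-- Every unbounded component meets the connected exterior of a large ball around the drawing, so
there is only one. -/
theorem PlaneDrawing.isPreconnected_outerFace [Finite V] (D : PlaneDrawing G) :
    IsPreconnected D.outerFace := by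
  obtain ⟨r, hr⟩ := D.isCompact_carrier.isBounded.exists_norm_le
  have hsub : {q : Plane | max r 0 < ‖q‖} ⊆ D.carrierᶜ := fun q hq hqK =>
    (not_lt.2 (hr q hqK)) ((le_max_left r 0).trans_lt hq)
  have hout : ∀ z ∈ D.outerFace, ∃ q, max r 0 < ‖q‖ ∧ q ∈ connectedComponentIn D.carrierᶜ z := by
    intro z hz
    by_contra hcon
    push Not at hcon
    refine hz.2 (isBounded_iff_forall_norm_le.2 ⟨max r 0, fun q hq => ?_⟩)
    by_contra hlt
    exact hcon q (not_le.1 hlt) hq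
  refine isPreconnected_of_forall_pair fun z hz z' hz' => ?_
  obtain ⟨q, hq, hqz⟩ := hout z hz
  obtain ⟨q', hq', hqz'⟩ := hout z' hz'
  have h1 := connectedComponentIn_eq hqz
  have h2 := connectedComponentIn_eq hqz'
  have h3 : q' ∈ connectedComponentIn D.carrierᶜ q :=
    (isPreconnected_norm_gt (le_max_right r 0)).subset_connectedComponentIn hq hsub hq'
  have h4 := connectedComponentIn_eq h3
  refine ⟨connectedComponentIn D.carrierᶜ z, fun p hp => ?_, mem_connectedComponentIn hz.1, ?_,
    isPreconnected_connectedComponentIn⟩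
  · exact ⟨connectedComponentIn_subset _ _ hp, connectedComponentIn_eq hp ▸ hz.2⟩
  · rw [h1, h4, ← h2]
    exact mem_connectedComponentIn hz'.1

/-- The point set of the drawing of the subgraph induced by `S`. -/
def PlaneDrawing.inducedCarrier (D : PlaneDrawing G) (S : Set V) : Set Plane :=
  D.pos '' S ∪ ⋃ e ∈ {e | e ∈ G.edgeSet ∧ ∀ t ∈ e, t ∈ S}, D.arc e

theorem PlaneDrawing.mem_inducedCarrier {D : PlaneDrawing G} {S : Set V} {z : Plane} :
    z ∈ D.inducedCarrier S ↔
      (∃ t ∈ S, D.pos t = z) ∨ ∃ e ∈ G.edgeSet, (∀ t ∈ e, t ∈ S) ∧ z ∈ D.arc e := by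
  simp only [inducedCarrier, Set.mem_union, Set.mem_image, Set.mem_iUnion, Set.mem_ofPred_eq,
    exists_prop, and_assoc]

theorem PlaneDrawing.inducedCarrier_subset (D : PlaneDrawing G) (S : Set V) :
    D.inducedCarrier S ⊆ D.carrier := by
  intro z hz
  rcases mem_inducedCarrier.1 hz with ⟨t, -, rfl⟩ | ⟨e, he, -, hz⟩
  · exact .inl ⟨t, rfl⟩
  · exact .inr (Set.mem_biUnion he hz)

theorem PlaneDrawing.arc_subset (D : PlaneDrawing G) {e : Sym2 V} (he : e ∈ G.edgeSet) :
    D.arc e ⊆ D.carrier := fun _ hz => .inr (Set.mem_biUnion he hz)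

theorem PlaneDrawing.isClosed_inducedCarrier [Finite V] (D : PlaneDrawing G) (S : Set V) :
    IsClosed (D.inducedCarrier S) :=
  ((Set.toFinite _).isCompact.union
    ((Set.toFinite _).isCompact_biUnion fun _ he => D.isCompact_arc he.1)).isClosed

/-- Logarithms of the arcs along a walk in `S` add up. -/
theorem PlaneDrawing.exists_log (D : PlaneDrawing G) {S : Set V} {a b : V} (ha : a ∈ S)
    (hab : ReflTransGen (fun s t => G.Adj s t ∧ s ∈ S ∧ t ∈ S) a b) :
    ∃ f : Plane → ℂ, ∀ q ∉ D.inducedCarrier S, ContinuousAt f q ∧ Complex.exp (f q) =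
      (toComplex (D.pos b) - toComplex q) / (toComplex (D.pos a) - toComplex q) := by
  have hpos : ∀ s ∈ S, ∀ q ∉ D.inducedCarrier S, toComplex (D.pos s) - toComplex q ≠ 0 := by
    intro s hs q hq
    exact toComplex_sub_ne_zero fun h =>
      hq (PlaneDrawing.mem_inducedCarrier.2 (.inl ⟨s, hs, h⟩))
  induction hab with
  | refl =>
    exact ⟨fun _ => 0, fun q hq => ⟨continuousAt_const, by
      rw [Complex.exp_zero, div_self (hpos a ha q hq)]⟩⟩
  | @tail s t _ hst ih =>
    obtain ⟨f, hf⟩ := ih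
    obtain ⟨m, R, h, hg⟩ := (D.isArc s t hst.1).exists_isArcGerm
    refine ⟨fun q => f q + (Complex.log ((toComplex m - toComplex q) /
      (toComplex (D.pos s) - toComplex q)) + h q), fun q hq => ?_⟩
    have hqA : q ∉ D.arc s(s, t) := fun hA => by
      refine hq (PlaneDrawing.mem_inducedCarrier.2 (.inr ⟨s(s, t), hst.1, fun r hr => ?_, hA⟩))
      rcases Sym2.mem_iff.1 hr with rfl | rfl
      · exact hst.2.1
      · exact hst.2.2
    obtain ⟨h1, h2⟩ := hf q hq
    obtain ⟨h3, h4⟩ := hg.log_arc hqA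
    refine ⟨h1.add h3, ?_⟩
    rw [Complex.exp_add, h2, h4]
    have := hpos s hst.2.1 q hq
    field_simp

theorem PlaneDrawing.not_isApexModel [Finite V] (D : PlaneDrawing G)
    (hD : ∀ v, D.pos v ∈ closure D.outerFace) {v : V} {C : Fin 3 → Set V}
    (hC : IsApexModel G v C) : False := by
  choose c hcC hvc using hC.apex
  choose m R h hg using fun i => (D.isArc v (c i) (hvc i)).exists_isArcGerm
  have hinj : ∀ i j, i ≠ j → c i ≠ c j := fun i j hij he =>
    hC.disj i j hij (c i) (hcC i) (he ▸ hcC j)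
  have hS : ∀ j, ∀ t ∈ {t | ∃ i, i ≠ j ∧ t ∈ C i}, t ≠ v ∧ t ∉ C j := by
    rintro j t ⟨i, hij, ht⟩
    exact ⟨fun he => hC.notMem i (he ▸ ht), hC.disj i j hij t ht⟩
  have hfaceA : ∀ e ∈ G.edgeSet, ∀ z ∈ D.outerFace, z ∉ D.arc e := fun e he z hz hA =>
    hz.1 (D.arc_subset he hA)
  -- `E j` is the drawing induced by the two branch sets other than `C j`: it joins their arc ends
  -- and misses the arc to `c j`.
  refine false_of_germs (v := D.pos v) (E := fun j => D.inducedCarrier {t | ∃ i, i ≠ j ∧ t ∈ C i})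
    hg ?_ (fun j => D.isClosed_inducedCarrier _) ?_ ?_ ?_ D.isPreconnected_outerFace
    (fun i => hfaceA _ (hvc i)) (fun j z hz hE => hz.1 (D.inducedCarrier_subset _ hE)) (hD v)
    (fun j => hD (c j))
  · intro i j hij z hzi hzj
    obtain ⟨w, hwi, hwj, rfl⟩ := D.arc_inter _ (hvc i) _ (hvc j) (fun he => by
      rcases Sym2.eq_iff.1 he with ⟨-, h⟩ | ⟨h, -⟩
      · exact hinj i j hij h
      · exact (hvc j).ne h) z hzi hzj
    rcases Sym2.mem_iff.1 hwi with rfl | rfl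
    · rfl
    · rcases Sym2.mem_iff.1 hwj with h | h
      · rw [h]
      · exact (hinj i j hij h).elim
  · intro j hv
    rcases PlaneDrawing.mem_inducedCarrier.1 hv with ⟨t, ht, he⟩ | ⟨e, he, heS, hve⟩
    · exact (hS j t ht).1 (D.pos_injective he)
    · exact (hS j v (heS v (D.vertex_on_arc e he v hve))).1 rfl
  · intro i j k hij hjk hik
    refine ⟨PlaneDrawing.mem_inducedCarrier.2 (.inl ⟨c i, ⟨i, hij, hcC i⟩, rfl⟩),
      D.exists_log ⟨i, hij, hcC i⟩ ?_⟩
    obtain ⟨a, ha, b, hb, hab⟩ := hC.adj i k hik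
    refine .trans (.tail (b := a) ?_ ⟨hab, ⟨i, hij, ha⟩, ⟨k, hjk.symm, hb⟩⟩) ?_
    · exact ReflTransGen.mono (fun s t hst => ⟨hst.1, ⟨i, hij, hst.2.1⟩, ⟨i, hij, hst.2.2⟩⟩) _ _
        (hC.conn i _ (hcC i) a ha)
    · exact ReflTransGen.mono
        (fun s t hst => ⟨hst.1, ⟨k, hjk.symm, hst.2.1⟩, ⟨k, hjk.symm, hst.2.2⟩⟩) _ _
        (hC.conn k b hb _ (hcC k))
  · intro j z hz hE
    have hmem : ∀ w ∈ s(v, c j), w ∉ {t | ∃ i, i ≠ j ∧ t ∈ C i} := by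
      intro w hw hwS
      rcases Sym2.mem_iff.1 hw with rfl | rfl
      · exact (hS j _ hwS).1 rfl
      · exact (hS j _ hwS).2 (hcC j)
    rcases PlaneDrawing.mem_inducedCarrier.1 hE with ⟨t, ht, rfl⟩ | ⟨e, he, heS, hze⟩
    · exact hmem t (D.vertex_on_arc _ (hvc j) t hz) ht
    · obtain ⟨w, hw, hwe, -⟩ := D.arc_inter _ (hvc j) e he (fun h => hmem v (Sym2.mem_mk_left _ _)
        (heS v (h ▸ Sym2.mem_mk_left _ _))) z hz hze
      exact hmem w hw (heS w hwe)

theorem IsOuterplanar.not_hasApexModel [Finite V] (hG : IsOuterplanar G) : ¬ HasApexModel G := by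
  rintro ⟨v, C, hC⟩
  obtain ⟨D, hD⟩ := hG
  exact D.not_isApexModel hD hC

end Drawings

/-! ### Forcing trees are the colour classes. -/

section ForcingTrees

variable {V : Type*} {ι : Type*} {G : SimpleGraph V}

theorem IsForcingList.exists_root {B B' : Set V} {l : List (V × V)} (h : IsForcingList G B l B') :
    ∀ v ∈ B', ∃ r ∈ B, ReflTransGen (fun a b => (a, b) ∈ l) r v := by
  induction h with
  | nil B => exact fun v hv => ⟨v, hv, .refl⟩
  | @cons B B' u w l hf _ ih =>
    intro v hv
    obtain ⟨r, hr, hrv⟩ := ih v hv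
    have hrv' : ReflTransGen (fun a b => (a, b) ∈ (u, w) :: l) r v :=
      ReflTransGen.mono (fun a b hab => List.mem_cons_of_mem _ hab) _ _ hrv
    rcases hr with rfl | hr
    · exact ⟨u, hf.1, .head (List.mem_cons_self ..) hrv'⟩
    · exact ⟨r, hr, hrv'⟩

/-- Colours are constant along forces and distinct roots have distinct colours, so each class is
reached from its own root only. -/
theorem forcingTree_verts {c : V → ι} {Z : Set V} {l : List (V × V)}
    (hl : IsForcingList G Z l Set.univ) (hc : ∀ p ∈ l, c p.1 = c p.2) (hinj : Set.InjOn c Z)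
    {r : V} (hr : r ∈ Z) (v : V) : v ∈ (forcingTree G l r).verts ↔ c v = c r := by
  have hpath : ∀ s t, ReflTransGen (fun a b => (a, b) ∈ l) s t → c s = c t := by
    intro s t hst
    induction hst with
    | refl => rfl
    | tail _ hbc ih => exact ih.trans (hc _ hbc)
  constructor
  · exact fun hv => (hpath _ _ hv).symm
  · intro hv
    obtain ⟨r', hr', hrv⟩ := hl.exists_root v trivial
    obtain rfl := hinj hr' hr ((hpath _ _ hrv).trans hv)
    exact hrv

/-- An edge of a class that carried no force would be bypassed by the forcing paths from the root to
its two ends, so it would not be a bridge. -/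
theorem forcingTree_adj {c : V → ι} (ha : ClassAcyclic G c) {Z : Set V} {l : List (V × V)}
    (hl : IsForcingList G Z l Set.univ) (hc : ∀ p ∈ l, c p.1 = c p.2) (hinj : Set.InjOn c Z)
    {r : V} (hr : r ∈ Z) (a b : V) :
    (forcingTree G l r).Adj a b ↔ c a = c r ∧ c b = c r ∧ G.Adj a b := by
  have hverts := forcingTree_verts hl hc hinj hr
  constructor
  · rintro ⟨h1, h2, h3, -⟩
    exact ⟨(hverts a).1 h1, (hverts b).1 h2, h3⟩
  · rintro ⟨h1, h2, h3⟩
    have ha' := (hverts a).2 h1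
    have hb' := (hverts b).2 h2
    refine ⟨ha', hb', h3, ?_⟩
    by_contra hcon
    rw [not_or] at hcon
    have hstep : ∀ s t, (s, t) ∈ l → MonoStep G c s t ∧ s(s, t) ≠ s(a, b) := by
      intro s t hst
      refine ⟨⟨hl.adj_of_mem _ hst, hc _ hst⟩, fun he => ?_⟩
      rcases Sym2.eq_iff.1 he with ⟨rfl, rfl⟩ | ⟨rfl, rfl⟩
      · exact hcon.1 hst
      · exact hcon.2 hst
    refine ha a b h3 (h1.trans h2.symm) (.trans ?_ (ReflTransGen.mono hstep _ _ hb'))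
    refine reflTransGen_symm (fun s t hst => ⟨monoStep_symm s t hst.1, ?_⟩)
      (ReflTransGen.mono hstep _ _ ha')
    rw [Sym2.eq_swap]
    exact hst.2

/-- In a graph without minor `K₄`, every tree covering is the set of forcing trees of a positive
zero forcing process. -/
theorem IsTreeCovering.exists_forcingTrees_eq [Finite V] (hG : ¬ HasApexModel G)
    {𝒯 : Set G.Subgraph} (h𝒯 : IsTreeCovering G 𝒯) :
    ∃ (Z : Set V) (l : List (V × V)), IsForcingList G Z l Set.univ ∧ Z.ncard = 𝒯.ncard ∧
      𝒯 = forcingTrees G Z l := by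
  obtain ⟨Z, l, hl, hc, hinj, hsurj⟩ := exists_isForcingList_of_classAcyclic G hG h𝒯.part
    h𝒯.classConnected h𝒯.classAcyclic
  have himg : h𝒯.part '' Z = 𝒯 := by
    ext H
    constructor
    · rintro ⟨r, -, rfl⟩
      exact h𝒯.part_mem r
    · intro hH
      obtain ⟨⟨v, hv⟩⟩ := (h𝒯.isTree H hH).connected.nonempty
      obtain ⟨r, hr, hrv⟩ := hsurj v
      exact ⟨r, hr, hrv.trans ((h𝒯.part_eq_iff hH).2 hv)⟩
  refine ⟨Z, l, hl, by rw [← himg, hinj.ncard_image], ?_⟩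
  conv_lhs => rw [← himg]
  refine Set.image_congr fun r hr => ?_
  have hmem : ∀ v, v ∈ (h𝒯.part r).verts ↔ h𝒯.part v = h𝒯.part r := fun v =>
    (h𝒯.part_eq_iff (h𝒯.part_mem r)).symm
  ext a b
  · rw [forcingTree_verts hl hc hinj hr, hmem]
  · rw [forcingTree_adj h𝒯.classAcyclic hl hc hinj hr, ← hmem, ← hmem]
    exact ⟨fun h => ⟨(h𝒯.part r).edge_vert h, (h𝒯.part r).edge_vert h.symm, (h𝒯.part r).adj_sub h⟩,
      fun h => h𝒯.isInduced _ (h𝒯.part_mem r) h.1 h.2.1 h.2.2⟩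

theorem positiveZeroForcingNumber_eq_treeCoverNumber [Finite V] (hG : ¬ HasApexModel G) :
    positiveZeroForcingNumber G = treeCoverNumber G := by
  apply le_antisymm
  · have hne : {m | ∃ 𝒯 : Set G.Subgraph, IsTreeCovering G 𝒯 ∧ 𝒯.ncard = m}.Nonempty := by
      obtain ⟨𝒯, h𝒯, -⟩ := IsPositiveZeroForcingSet.exists_isTreeCovering
        (G := G) (Z := Set.univ) ⟨[], IsForcingList.nil _⟩
      exact ⟨_, 𝒯, h𝒯, rfl⟩
    obtain ⟨𝒯, h𝒯, hcard⟩ := Nat.sInf_mem hne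
    obtain ⟨Z, l, hl, hZ, -⟩ := h𝒯.exists_forcingTrees_eq hG
    exact Nat.sInf_le ⟨Z, ⟨l, hl⟩, hZ.trans hcard⟩
  · have hne : {m | ∃ Z : Set V, IsPositiveZeroForcingSet G Z ∧ Z.ncard = m}.Nonempty :=
      ⟨_, Set.univ, ⟨[], IsForcingList.nil _⟩, rfl⟩
    obtain ⟨Z, hZ, hcard⟩ := Nat.sInf_mem hne
    obtain ⟨𝒯, h𝒯, hle⟩ := hZ.exists_isTreeCovering
    have hT : treeCoverNumber G ≤ 𝒯.ncard := Nat.sInf_le ⟨𝒯, h𝒯, rfl⟩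
    exact hT.trans (hle.trans hcard.le)

end ForcingTrees

end OuterplanarForcing
-- The theorem for outerplanar graphs.
theorem mainTheorem1 {V : Type*} [Finite V] [Nonempty V] (G : SimpleGraph V)
    (hG : OuterplanarForcing.IsOuterplanar G) :
    OuterplanarForcing.positiveZeroForcingNumber G = OuterplanarForcing.treeCoverNumber G ∧
      ∀ 𝒯 : Set G.Subgraph, OuterplanarForcing.IsTreeCovering G 𝒯 →
        𝒯.ncard = OuterplanarForcing.treeCoverNumber G →
        ∃ (Z : Set V) (l : List (V × V)),
          OuterplanarForcing.IsForcingList G Z l Set.univ ∧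
          Z.ncard = OuterplanarForcing.positiveZeroForcingNumber G ∧
          𝒯 = OuterplanarForcing.forcingTrees G Z l := by
  have hG' := hG.not_hasApexModel
  have hZT := OuterplanarForcing.positiveZeroForcingNumber_eq_treeCoverNumber hG'
  refine ⟨hZT, fun 𝒯 h𝒯 hcard => ?_⟩
  obtain ⟨Z, l, hl, hZ, heq⟩ := h𝒯.exists_forcingTrees_eq hG'
  exact ⟨Z, l, hl, hZ.trans (hcard.trans hZT.symm), heq⟩
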